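/- Let $O_{A_{\mathbb N}}$ be the universal $C^*$-algebra generated by a sequence $\{s_i : i=0,1,2,\dots\}$ of partial isometries subject to the relations $$s_i^*s_j=0\quad (i\neq j),\qquad s_i^*s_i=\sum_{k=0}^{i}s_ks_k^*\quad (i\ge 0),$$ and let $J\subset O_{A_{\mathbb N}}$ be the closed two-sided ideal generated by $s_0-s_0s_0^*$. Let $\mathcal F$ be the weakly monotone Fock space over $\ell^2(\{1,2,\dots\})$, i.e. the Hilbert space with orthonormal basis the vectors $e_{i_1}\otimes\cdots\otimes e_{i_k}$ with $k\ge 0$ and $i_1\ge i_2\ge\cdots\ge i_k\ge 1$ (for $k=0$ this is the vacuum vector $\Omega$). For $i\ge 1$ let $A_i^\dagger\in\mathcal B(\mathcal F)$ be the creator given by $A_i^\dagger\Omega=e_i$ and, for $k\ge1$, $A_i^\dagger(e_{i_1}\otimes\cdots\otimes e_{i_k})=e_i\otimes e_{i_1}\otimes\cdots\otimes e_{i_k}$ if $i\ge i_1$ and $0$ otherwise, let $A_i=(A_i^\dagger)^*$, let $P_\Omega$ be the orthogonal projection onto $\mathbb C\Omega$, and let $\mathcal W_{\mathbb N}\subset\mathcal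 B(\mathcal F)$ be the (not necessarily unital) $C^*$-algebra generated by $\{A_i,A_i^\dagger : i\ge 1\}$. Then: 1. There is a representation $\pi_F: O_{A_{\mathbb N}}\to\mathcal B(\mathcal F)$ (the Fock representation) with $\pi_F(s_0)=P_\Omega$ and $\pi_F(s_i)=A_i^\dagger$ for $i\ge1$, and it induces an isometric $*$-isomorphism $O_{A_{\mathbb N}}/J\to\mathcal W_{\mathbb N}$, $[x]\mapsto\pi_F(x)$, where the quotient carries the quotient norm. 2. $\mathcal W_{\mathbb N}$ is isomorphic to the universal $C^*$-algebra generated by a sequence of partial isometries $\{s_i: i\ge 0\}$ satisfying the above relations together with $s_0=s_0s_0^*$, via $s_0\mapsto P_\Omega$ and $s_i\mapsto A_i^\dagger$ for $i\ge1$. That is, $P_\Omega\in\mathcal W_{\mathbb N}$, the family $(P_\Omega,A_1^\dagger,A_2^\dagger,\dots)$ satisfies these relations, and for every sequence $(t_i)_{i\ge0}$ of partial isometries in a $C^*$-algebra $B$ satisfying them there is a unique $*$-homomorphism $\varphi:\mathcal W_{\mathbb N}\to B$ with $\varphi(P_\Omega)=t_0$ and $\varphi(A_i^\dagger)=t_i$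 for $i\ge1$. -/

import Mathlib

universe u v

noncomputable section

open scoped ENNReal

namespace WeaklyMonotone

/-! ### Relations -/

/-- A family `t 0, t 1, …` in a C⋆-algebra consists of partial isometries and satisfies
`tᵢ* tⱼ = 0` for `i ≠ j` and `tᵢ* tᵢ = ∑_{k ≤ i} tₖ tₖ*` for all `i`. -/
structure MonotoneRel {B : Type v} [NonUnitalCStarAlgebra B] (t : ℕ → B) : Prop where
  partialIsometry : ∀ i, t i * star (t i) * t i = t i
  orthogonal : ∀ i j, i ≠ j → star (t i) * t j = 0
  sum_range : ∀ i, star (t i) * t i = ∑ k ∈ Finset.range (i + 1), t k * star (t k)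

/-- The relations of `MonotoneRel` together with `t₀ = t₀ t₀*`. -/
structure VacuumRel {B : Type v} [NonUnitalCStarAlgebra B] (t : ℕ → B) : Prop
    extends MonotoneRel t where
  vacuum : t 0 = t 0 * star (t 0)

lemma norm_le_one_of_partialIsometry {B : Type v} [NonUnitalCStarAlgebra B] {x : B}
    (hx : x * star x * x = x) : ‖x‖ ≤ 1 := by
  have h2 : star x * x * (star x * x) = star x * x := by
    rw [mul_assoc, ← mul_assoc x, hx]
  have h3 : ‖star x * x‖ * ‖star x * x‖ = ‖star x * x‖ := by
    have := CStarRing.norm_star_mul_self (x := star x * x)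
    rw [star_mul, star_star, h2] at this
    exact this.symm
  have h4 : ‖star x * x‖ = ‖x‖ * ‖x‖ := CStarRing.norm_star_mul_self
  by_contra! h
  have h5 : 1 < ‖star x * x‖ := by rw [h4]; nlinarith
  nlinarith

/-! ### Universal C⋆-algebras generated by partial isometries -/

/-- A sequence of partial isometries satisfying the relations `P`, in some C⋆-algebra. -/
structure Model (P : ∀ (B : Type u) [NonUnitalCStarAlgebra B], (ℕ → B) → Prop) where
  /-- the C⋆-algebra -/
  alg : Type u
  /-- its structure -/
  [inst : NonUnitalCStarAlgebra alg]
  /-- the family -/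
  gen : ℕ → alg
  partialIsometry : ∀ i, gen i * star (gen i) * gen i = gen i
  rel : P alg gen

attribute [instance] Model.inst

variable (P : ∀ (B : Type u) [NonUnitalCStarAlgebra B], (ℕ → B) → Prop)

/-- The ℓ^∞-product of all models, a C⋆-algebra. -/
abbrev ModelProduct : Type (u + 1) := lp (fun r : Model P => r.alg) ∞

/-- The family in the product of all models whose component in each model is its given family. -/
def productGen (i : ℕ) : ModelProduct P :=
  ⟨fun r => r.gen i, memℓp_infty ⟨1, by
    rintro _ ⟨r, rfl⟩
    exact norm_le_one_of_partialIsometry (r.partialIsometry i)⟩⟩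

/-- The universal C⋆-algebra generated by a sequence of partial isometries subject to the
relations `P`: the C⋆-subalgebra generated by the canonical family in the product of all models.
Thus the norm of a ⋆-polynomial in the generators is the supremum of its norms in all models. -/
def universalSubalgebra : NonUnitalStarSubalgebra ℂ (ModelProduct P) :=
  (NonUnitalStarAlgebra.adjoin ℂ (Set.range (productGen P))).topologicalClosure

instance : IsClosed (universalSubalgebra P : Set (ModelProduct P)) :=
  NonUnitalStarSubalgebra.isClosed_topologicalClosure _

/-- The universal C⋆-algebra, as a type. -/
def UniversalCStar : Type (u + 1) := universalSubalgebra P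

instance : NonUnitalCStarAlgebra (UniversalCStar P) :=
  inferInstanceAs (NonUnitalCStarAlgebra (universalSubalgebra P))

/-- The canonical generators of the universal C⋆-algebra. -/
def universalGen (i : ℕ) : UniversalCStar P :=
  ⟨productGen P i, NonUnitalStarSubalgebra.le_topologicalClosure _
    (NonUnitalStarAlgebra.subset_adjoin ℂ _ ⟨i, rfl⟩)⟩

/-- Projection of the universal C⋆-algebra to a model. -/
def evalModel (r : Model P) : UniversalCStar P →⋆ₙₐ[ℂ] r.alg where
  toFun x := x.1 r
  map_smul' _ _ := rfl
  map_zero' := rfl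
  map_add' _ _ := rfl
  map_mul' _ _ := rfl
  map_star' _ := rfl

/-- ⋆-homomorphisms on a generated C⋆-subalgebra that agree on the generators are equal. -/
lemma hom_ext_of_generates {C : Type v} [NonUnitalCStarAlgebra C] {B : Type u}
    [NonUnitalCStarAlgebra B] (X : Set C) (S : NonUnitalStarSubalgebra ℂ C)
    (hS : S = (NonUnitalStarAlgebra.adjoin ℂ X).topologicalClosure)
    [hc : IsClosed (S : Set C)] (ψ φ : S →⋆ₙₐ[ℂ] B)
    (h : ∀ x (hx : x ∈ S), x ∈ X → ψ ⟨x, hx⟩ = φ ⟨x, hx⟩) : ψ = φ := by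
  have hle : NonUnitalStarAlgebra.adjoin ℂ X ≤ S :=
    hS ▸ NonUnitalStarSubalgebra.le_topologicalClosure _
  have key : ∀ (x : C) (_ : x ∈ NonUnitalStarAlgebra.adjoin ℂ X) (hx' : x ∈ S),
      ψ ⟨x, hx'⟩ = φ ⟨x, hx'⟩ := by
    intro x hx
    induction hx using NonUnitalStarAlgebra.adjoin_induction with
    | mem x hx => exact fun hx' => h x hx' hx
    | add x y hx hy ihx ihy =>
      intro _
      have : ψ _ + ψ _ = φ _ + φ _ := congrArg₂ (· + ·) (ihx (hle hx)) (ihy (hle hy))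
      rw [← map_add, ← map_add] at this; exact this
    | zero => intro _; exact (map_zero ψ).trans (map_zero φ).symm
    | mul x y hx hy ihx ihy =>
      intro _
      have : ψ _ * ψ _ = φ _ * φ _ := congrArg₂ (· * ·) (ihx (hle hx)) (ihy (hle hy))
      rw [← map_mul, ← map_mul] at this; exact this
    | smul c x hx ihx =>
      intro _
      have : c • ψ _ = c • φ _ := congrArg (c • ·) (ihx (hle hx))
      rw [← map_smul, ← map_smul] at this; exact this
    | star x hx ihx =>
      intro _
      have : star (ψ _) = star (φ _) := congrArg star (ihx (hle hx))
      rw [← map_star, ← map_star] at this; exact this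
  have hd : Dense {x : S | x.1 ∈ NonUnitalStarAlgebra.adjoin ℂ X} := by
    intro x
    rw [closure_subtype]
    have hx : x.1 ∈ closure (NonUnitalStarAlgebra.adjoin ℂ X : Set C) := by
      have h1 : S ≤ (NonUnitalStarAlgebra.adjoin ℂ X).topologicalClosure := hS.le
      exact h1 x.2
    refine closure_mono ?_ hx
    intro y hy
    exact ⟨⟨y, hle hy⟩, hy, rfl⟩
  have hcont : ∀ χ : S →⋆ₙₐ[ℂ] B, Continuous χ := fun χ =>
    AddMonoidHomClass.continuous_of_bound χ 1 fun x => by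
      simpa using NonUnitalStarAlgHom.norm_apply_le χ x
  exact DFunLike.coe_injective
    (Continuous.ext_on hd (hcont ψ) (hcont φ) fun x hx => key x.1 hx x.2)

/-- The universal property: every family of partial isometries satisfying the relations is
the image of the canonical generators under a unique ⋆-homomorphism. -/
theorem existsUnique_lift {B : Type u} [NonUnitalCStarAlgebra B] (t : ℕ → B)
    (hpi : ∀ i, t i * star (t i) * t i = t i) (ht : P B t) :
    ∃! φ : UniversalCStar P →⋆ₙₐ[ℂ] B, ∀ i, φ (universalGen P i) = t i := by
  refine ⟨evalModel P ⟨B, t, hpi, ht⟩, fun i => rfl, fun ψ hψ => ?_⟩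
  refine hom_ext_of_generates (Set.range (productGen P)) (universalSubalgebra P) rfl ψ
    (evalModel P ⟨B, t, hpi, ht⟩) ?_
  rintro _ _ ⟨i, rfl⟩
  exact hψ i

/-! ### The two universal algebras -/

/-- `O_{A_ℕ}`: the universal C⋆-algebra generated by partial isometries `s₀, s₁, …` with
`sᵢ* sⱼ = 0` for `i ≠ j` and `sᵢ* sᵢ = ∑_{k ≤ i} sₖ sₖ*`. -/
abbrev OAN : Type (u + 1) := UniversalCStar.{u} fun _ _ t => MonotoneRel t

/-- The generators of `O_{A_ℕ}`. -/
def OAN.s (i : ℕ) : OAN.{u} := universalGen.{u} _ i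

/-- The universal C⋆-algebra generated by partial isometries satisfying the relations of
`O_{A_ℕ}` and `s₀ = s₀ s₀*`. -/
abbrev VacuumOAN : Type (u + 1) := UniversalCStar.{u} fun _ _ t => VacuumRel t

/-- Its generators. -/
def VacuumOAN.s (i : ℕ) : VacuumOAN.{u} := universalGen.{u} _ i

lemma productGen_rel (hP : ∀ (B : Type u) [NonUnitalCStarAlgebra B] (t : ℕ → B), P B t →
    MonotoneRel t) : MonotoneRel (universalGen P) where
  partialIsometry i := by
    apply Subtype.ext; apply Subtype.ext; funext r
    exact r.partialIsometry i
  orthogonal i j hij := by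
    apply Subtype.ext; apply Subtype.ext; funext r
    exact (hP _ _ r.rel).orthogonal i j hij
  sum_range i := by
    apply Subtype.ext; apply Subtype.ext; funext r
    have h := (hP _ _ r.rel).sum_range i
    have h2 : ((∑ k ∈ Finset.range (i + 1), universalGen P k * star (universalGen P k) :
        UniversalCStar P).1 r : r.alg) = ∑ k ∈ Finset.range (i + 1), r.gen k * star (r.gen k) :=
      map_sum (evalModel P r) _ _
    exact h.trans h2.symm

theorem OAN.rel : MonotoneRel OAN.s.{u} := productGen_rel _ fun _ _ _ h => h

theorem VacuumOAN.rel : VacuumRel VacuumOAN.s.{u} where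
  toMonotoneRel := productGen_rel _ fun _ _ _ h => h.toMonotoneRel
  vacuum := by
    apply Subtype.ext; apply Subtype.ext; funext r
    exact r.rel.vacuum

/-! ### Closed ideals and quotients -/

section Quotient

variable {A : Type v} [NonUnitalCStarAlgebra A]

/-- A norm-closed two-sided ideal. -/
structure IsClosedIdeal (K : Submodule ℂ A) : Prop where
  closed : IsClosed (K : Set A)
  mul_left : ∀ a x, x ∈ K → a * x ∈ K
  mul_right : ∀ a x, x ∈ K → x * a ∈ K

/-- The closed two-sided ideal generated by a set. -/
def closedIdealSpan (S : Set A) : Submodule ℂ A :=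
  sInf {K | IsClosedIdeal K ∧ S ⊆ K}

lemma isClosedIdeal_closedIdealSpan (S : Set A) : IsClosedIdeal (closedIdealSpan S) where
  closed := by
    rw [closedIdealSpan, Submodule.coe_sInf]
    exact isClosed_biInter fun K hK => hK.1.closed
  mul_left a x hx := by
    rw [closedIdealSpan, Submodule.mem_sInf] at *
    exact fun K hK => hK.1.mul_left a x (hx K hK)
  mul_right a x hx := by
    rw [closedIdealSpan, Submodule.mem_sInf] at *
    exact fun K hK => hK.1.mul_right a x (hx K hK)

lemma subset_closedIdealSpan (S : Set A) : S ⊆ closedIdealSpan S := fun x hx => by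
  rw [SetLike.mem_coe, closedIdealSpan, Submodule.mem_sInf]
  exact fun K hK => hK.2 hx

lemma star_mem_closedIdealSpan {S : Set A} (hS : ∀ x ∈ S, star x ∈ closedIdealSpan S)
    {x : A} (hx : x ∈ closedIdealSpan S) : star x ∈ closedIdealSpan S := by
  have hI := isClosedIdeal_closedIdealSpan S
  let K : Submodule ℂ A :=
    { carrier := {y | star y ∈ closedIdealSpan S}
      add_mem' := fun {a b} ha hb => by
        simpa only [Set.mem_ofPred_eq, star_add] using add_mem ha hb
      zero_mem' := by simp
      smul_mem' := fun c a ha => by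
        simpa only [Set.mem_ofPred_eq, star_smul] using Submodule.smul_mem _ (star c) ha }
  have hK : IsClosedIdeal K :=
    { closed := hI.closed.preimage continuous_star
      mul_left := fun a y hy => by
        change star (a * y) ∈ closedIdealSpan S
        rw [star_mul]; exact hI.mul_right _ _ hy
      mul_right := fun a y hy => by
        change star (y * a) ∈ closedIdealSpan S
        rw [star_mul]; exact hI.mul_left _ _ hy }
  exact (sInf_le (a := K) ⟨hK, hS⟩ : closedIdealSpan S ≤ K) hx

variable (A) in
/-- Norm-closed two-sided ideals of a C⋆-algebra. Stability under the involution, which holds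
automatically, is recorded so that the quotient is visibly a ⋆-algebra. -/
structure CStarIdeal where
  /-- the underlying subspace -/
  carrier : Submodule ℂ A
  isClosedIdeal : IsClosedIdeal carrier
  star_mem : ∀ x ∈ carrier, star x ∈ carrier

namespace CStarIdeal

variable (I : CStarIdeal A)

instance : IsClosed (I.carrier : Set A) := I.isClosedIdeal.closed

/-- The quotient of a C⋆-algebra by a closed two-sided ideal. -/
def Quot : Type v := A ⧸ I.carrier

/-- The quotient norm `‖[x]‖ = inf {‖x + y‖ : y ∈ I}`. -/
instance : NormedAddCommGroup I.Quot := inferInstanceAs (NormedAddCommGroup (A ⧸ I.carrier))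
instance : NormedSpace ℂ I.Quot := inferInstanceAs (NormedSpace ℂ (A ⧸ I.carrier))
instance : CompleteSpace I.Quot := inferInstanceAs (CompleteSpace (A ⧸ I.carrier))

/-- The canonical projection. -/
def toQuot : A →ₗ[ℂ] I.Quot := I.carrier.mkQ

variable {I}

lemma mk_eq_mk {x y : A} : I.toQuot x = I.toQuot y ↔ x - y ∈ I.carrier := Submodule.Quotient.eq _

lemma mk_surjective : Function.Surjective I.toQuot := Submodule.mkQ_surjective _

instance : Mul I.Quot where
  mul := Quotient.map₂ (· * ·) (by
    intro a b hab c d hcd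
    have h1 := (Submodule.quotientRel_def _).1 hab
    have h2 := (Submodule.quotientRel_def _).1 hcd
    refine (Submodule.quotientRel_def _).2 ?_
    have : a * c - b * d = a * (c - d) + (a - b) * d := by
      rw [mul_sub, sub_mul]; abel
    change a * c - b * d ∈ _
    rw [this]
    exact add_mem (I.isClosedIdeal.mul_left _ _ h2) (I.isClosedIdeal.mul_right _ _ h1))

instance : Star I.Quot where
  star := Quotient.map star (by
    intro a b hab
    have h1 := (Submodule.quotientRel_def _).1 hab
    refine (Submodule.quotientRel_def _).2 ?_
    rw [← star_sub]
    exact I.star_mem _ h1)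

lemma mk_mul (x y : A) : I.toQuot (x * y) = I.toQuot x * I.toQuot y := rfl

lemma mk_star (x : A) : I.toQuot (star x) = star (I.toQuot x) := rfl

lemma norm_mk_lt (q : I.Quot) {ε : ℝ} (hε : 0 < ε) : ∃ x, I.toQuot x = q ∧ ‖x‖ < ‖q‖ + ε :=
  QuotientAddGroup.exists_norm_mk_lt (S := I.carrier.toAddSubgroup) q hε

lemma norm_mk_le (x : A) : ‖I.toQuot x‖ ≤ ‖x‖ :=
  QuotientAddGroup.norm_mk_le_norm (S := I.carrier.toAddSubgroup)

instance : NonUnitalNormedRing I.Quot where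
  left_distrib a b c := by
    obtain ⟨a, rfl⟩ := mk_surjective a; obtain ⟨b, rfl⟩ := mk_surjective b
    obtain ⟨c, rfl⟩ := mk_surjective c
    simp only [← mk_mul, ← map_add, mul_add]
  right_distrib a b c := by
    obtain ⟨a, rfl⟩ := mk_surjective a; obtain ⟨b, rfl⟩ := mk_surjective b
    obtain ⟨c, rfl⟩ := mk_surjective c
    simp only [← mk_mul, ← map_add, add_mul]
  zero_mul a := by
    obtain ⟨a, rfl⟩ := mk_surjective a
    rw [← map_zero I.toQuot, ← mk_mul, zero_mul]
  mul_zero a := by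
    obtain ⟨a, rfl⟩ := mk_surjective a
    rw [← map_zero I.toQuot, ← mk_mul, mul_zero]
  mul_assoc a b c := by
    obtain ⟨a, rfl⟩ := mk_surjective a; obtain ⟨b, rfl⟩ := mk_surjective b
    obtain ⟨c, rfl⟩ := mk_surjective c
    simp only [← mk_mul, mul_assoc]
  dist_eq := NormedAddGroup.dist_eq
  norm_mul_le a b := by
    have key : ∀ ε : ℝ, 0 < ε → ‖a * b‖ ≤ (‖a‖ + ε) * (‖b‖ + ε) := by
      intro ε hε
      obtain ⟨x, rfl, hx⟩ := norm_mk_lt a hε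
      obtain ⟨y, rfl, hy⟩ := norm_mk_lt b hε
      rw [← mk_mul]
      calc ‖I.toQuot (x * y)‖ ≤ ‖x * y‖ := norm_mk_le _
        _ ≤ ‖x‖ * ‖y‖ := norm_mul_le _ _
        _ ≤ _ := by gcongr
    have hlim : Filter.Tendsto (fun ε : ℝ => (‖a‖ + ε) * (‖b‖ + ε)) (nhdsWithin 0 (Set.Ioi 0))
        (nhds (‖a‖ * ‖b‖)) := by
      have : Continuous fun ε : ℝ => (‖a‖ + ε) * (‖b‖ + ε) := by fun_prop
      simpa using (this.tendsto 0).mono_left nhdsWithin_le_nhds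
    refine ge_of_tendsto hlim ?_
    filter_upwards [self_mem_nhdsWithin] with ε hε using key ε hε

instance : StarRing I.Quot where
  star_involutive a := by
    obtain ⟨a, rfl⟩ := mk_surjective a
    simp only [← mk_star, star_star]
  star_mul a b := by
    obtain ⟨a, rfl⟩ := mk_surjective a; obtain ⟨b, rfl⟩ := mk_surjective b
    simp only [← mk_star, ← mk_mul, star_mul]
  star_add a b := by
    obtain ⟨a, rfl⟩ := mk_surjective a; obtain ⟨b, rfl⟩ := mk_surjective b
    simp only [← mk_star, ← map_add, star_add]

end CStarIdeal

end Quotient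

/-- The closed two-sided ideal `J` of `O_{A_ℕ}` generated by `s₀ - s₀ s₀*`. -/
def J : CStarIdeal OAN.{u} where
  carrier := closedIdealSpan {OAN.s 0 - OAN.s 0 * star (OAN.s 0)}
  isClosedIdeal := isClosedIdeal_closedIdealSpan _
  star_mem _ hx := star_mem_closedIdealSpan (by
    rintro _ rfl
    have hI := isClosedIdeal_closedIdealSpan {OAN.s.{u} 0 - OAN.s 0 * star (OAN.s 0)}
    have hm := hI.mul_left (-star (OAN.s 0)) _ (subset_closedIdealSpan _ rfl)
    have h0 : star (OAN.s.{u} 0) * OAN.s 0 = OAN.s 0 * star (OAN.s 0) := by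
      simpa using OAN.rel.sum_range 0
    have h1 : star (OAN.s.{u} 0) * (OAN.s 0 * star (OAN.s 0)) = star (OAN.s 0) := by
      have := congrArg star (OAN.rel.{u}.partialIsometry 0)
      simpa [star_mul, mul_assoc] using this
    convert hm using 1
    rw [neg_mul, mul_sub, h1, h0, star_sub, star_mul, star_star, neg_sub]) hx

/-! ### The weakly monotone Fock space over `ℕ = {1, 2, …}` -/

/-- Words `i₁ ≥ i₂ ≥ ⋯ ≥ iₖ ≥ 1`; the empty word is allowed. -/
abbrev Word : Type := {l : List ℕ+ // l.IsChain (· ≥ ·)}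

/-- The weakly monotone Fock space: the Hilbert space with orthonormal basis
`e_{i₁} ⊗ ⋯ ⊗ e_{iₖ}`, `i₁ ≥ ⋯ ≥ iₖ ≥ 1`, `k ≥ 0`. -/
abbrev Fock : Type := lp (fun _ : Word => ℂ) 2

open Classical in
/-- The basis vector `e_{i₁} ⊗ ⋯ ⊗ e_{iₖ}`. -/
def basisVec (γ : Word) : Fock := lp.single 2 γ 1

lemma basisVec_self (γ : Word) : basisVec γ γ = 1 := by
  classical exact lp.single_apply_self (E := fun _ : Word => ℂ) 2 γ 1

lemma basisVec_ne {γ δ : Word} (h : δ ≠ γ) : basisVec γ δ = 0 := by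
  classical exact lp.single_apply_ne (E := fun _ : Word => ℂ) 2 γ 1 h

/-- The vacuum vector, indexed by the empty word. -/
def vac : Fock := basisVec ⟨[], List.isChain_nil⟩

/-- The coefficients of `A†ᵢ f`. -/
def creationFun (i : ℕ+) (f : Word → ℂ) : Word → ℂ
  | ⟨[], _⟩ => 0
  | ⟨j :: l, h⟩ => if j = i then f ⟨l, h.tail⟩ else 0

lemma creationFun_cons (i : ℕ+) (f : Word → ℂ) (j : ℕ+) (l : List ℕ+) (h) :
    creationFun i f ⟨j :: l, h⟩ = if j = i then f ⟨l, h.tail⟩ else 0 := rfl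

/-- Prepend the letter `i` to a word. -/
def consWord (i : ℕ+) (γ : {γ : Word // (i :: γ.1).IsChain (· ≥ ·)}) : Word := ⟨i :: γ.1.1, γ.2⟩

lemma consWord_injective (i : ℕ+) : Function.Injective (consWord i) := by
  rintro ⟨⟨a, ha⟩, ha'⟩ ⟨⟨b, hb⟩, hb'⟩ h
  have := congrArg Subtype.val h
  simp only [consWord, List.cons.injEq, true_and] at this
  subst this; rfl

lemma creationFun_eq_zero {i : ℕ+} {f : Word → ℂ} {γ : Word}
    (h : γ ∉ Set.range (consWord i)) : creationFun i f γ = 0 := by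
  obtain ⟨_ | ⟨j, l⟩, hl⟩ := γ
  · rfl
  · simp only [creationFun]
    split_ifs with hj
    · subst hj; exact absurd ⟨⟨⟨l, hl.tail⟩, hl⟩, rfl⟩ h
    · rfl

lemma creationFun_consWord (i : ℕ+) (f : Word → ℂ) (γ) :
    creationFun i f (consWord i γ) = f γ.1 := by
  simp only [consWord, creationFun, if_true]

lemma hasSum_sq (f : Fock) : HasSum (fun γ => ‖f γ‖ ^ 2) (‖f‖ ^ 2) := by
  simpa using lp.hasSum_norm (p := 2) (by norm_num) f

lemma creationFun_summable (i : ℕ+) (f : Fock) :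
    Summable fun γ => ‖creationFun i f γ‖ ^ 2 := by
  refine ((consWord_injective i).summable_iff fun γ hγ => ?_).1 ?_
  · rw [creationFun_eq_zero hγ]; simp
  · simp only [Function.comp_def, creationFun_consWord]
    exact (hasSum_sq f).summable.subtype _

lemma creationFun_memℓp (i : ℕ+) (f : Fock) : Memℓp (creationFun i f) 2 :=
  memℓp_gen (by simpa using creationFun_summable i f)

/-- `A†ᵢ` as a linear map. -/
def creationLin (i : ℕ+) : Fock →ₗ[ℂ] Fock where
  toFun f := ⟨creationFun i f, creationFun_memℓp i f⟩
  map_add' f g := by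
    apply Subtype.ext; funext ⟨l, hl⟩
    rcases l with _ | ⟨j, l⟩
    · exact (add_zero (0 : ℂ)).symm
    · change creationFun i (f + g) ⟨j :: l, hl⟩ =
        creationFun i f ⟨j :: l, hl⟩ + creationFun i g ⟨j :: l, hl⟩
      by_cases hj : j = i <;> simp only [creationFun_cons, hj, if_true, if_false]
      · rfl
      · exact (add_zero (0 : ℂ)).symm
  map_smul' c f := by
    apply Subtype.ext; funext ⟨l, hl⟩
    rcases l with _ | ⟨j, l⟩
    · exact (mul_zero c).symm
    · change creationFun i (c • f) ⟨j :: l, hl⟩ = c * creationFun i f ⟨j :: l, hl⟩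
      by_cases hj : j = i <;> simp only [creationFun_cons, hj, if_true, if_false]
      · rfl
      · exact (mul_zero c).symm

/-- The weakly monotone creator `A†ᵢ`; see `creation_basisVec` for its action on the basis. -/
def creation (i : ℕ+) : Fock →L[ℂ] Fock :=
  (creationLin i).mkContinuous 1 fun f => by
    rw [one_mul]
    refine le_of_sq_le_sq ?_ (norm_nonneg _)
    rw [← (hasSum_sq f).tsum_eq, ← (hasSum_sq (creationLin i f)).tsum_eq]
    have h1 : ∑' γ, ‖creationLin i f γ‖ ^ 2 = ∑' γ, ‖creationFun i f (consWord i γ)‖ ^ 2 :=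
      ((consWord_injective i).tsum_eq (f := fun γ => ‖creationFun i f γ‖ ^ 2) fun γ hγ => by
        by_contra h
        exact hγ (by simp [creationFun_eq_zero h])).symm
    rw [h1]
    simp only [creationFun_consWord]
    exact Summable.tsum_subtype_le (fun γ => ‖f γ‖ ^ 2) _ (fun _ => by positivity)
      (hasSum_sq f).summable

open Classical in
/-- `A†ᵢ e_{i₁} ⊗ ⋯ ⊗ e_{iₖ} = eᵢ ⊗ e_{i₁} ⊗ ⋯ ⊗ e_{iₖ}` if the word is empty or `i ≥ i₁`,
and `0` otherwise. -/
theorem creation_basisVec (i : ℕ+) (γ : Word) :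
    creation i (basisVec γ) = if h : ∀ j ∈ γ.1.head?, i ≥ j then
      basisVec ⟨i :: γ.1, List.isChain_cons.2 ⟨h, γ.2⟩⟩ else 0 := by
  apply Subtype.ext; funext δ
  change creationFun i (basisVec γ) δ = _
  by_cases hδ : δ ∈ Set.range (consWord i)
  · obtain ⟨ε, rfl⟩ := hδ
    rw [creationFun_consWord]
    have hε := ε.2
    split_ifs with h
    · by_cases hγ : ε.1 = γ
      · subst hγ; rw [basisVec_self]; exact (basisVec_self _).symm
      · rw [basisVec_ne hγ]
        refine (basisVec_ne ?_).symm
        intro h'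
        apply hγ
        have := congrArg Subtype.val h'
        simp only [consWord, List.cons.injEq, true_and] at this
        exact Subtype.ext this
    · have hγ : ε.1 ≠ γ := by
        rintro rfl; exact h (List.isChain_cons.1 hε).1
      rw [basisVec_ne hγ]; rfl
  · rw [creationFun_eq_zero hδ]
    split_ifs with h
    · refine (basisVec_ne ?_).symm
      rintro rfl
      exact hδ ⟨⟨γ, List.isChain_cons.2 ⟨h, γ.2⟩⟩, rfl⟩
    · rfl

/-- The annihilator `Aᵢ`, the adjoint of `A†ᵢ`. -/
def annihilation (i : ℕ+) : Fock →L[ℂ] Fock := ContinuousLinearMap.adjoint (creation i)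

/-- The orthogonal projection `P_Ω` onto the span of the vacuum vector. -/
def vacProj : Fock →L[ℂ] Fock := (Submodule.span ℂ {vac}).starProjection

/-- The weakly monotone C⋆-algebra `𝒲_ℕ`: the (non-unital) C⋆-algebra of operators generated by
all creators and annihilators. -/
def weaklyMonotoneAlg : NonUnitalStarSubalgebra ℂ (Fock →L[ℂ] Fock) :=
  (NonUnitalStarAlgebra.adjoin ℂ
    (Set.range annihilation ∪ Set.range creation)).topologicalClosure

instance : IsClosed (weaklyMonotoneAlg : Set (Fock →L[ℂ] Fock)) :=
  NonUnitalStarSubalgebra.isClosed_topologicalClosure _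

/-- The images of the generators under the Fock representation: `s₀ ↦ P_Ω`, `sᵢ ↦ A†ᵢ`
for `i ≥ 1`. -/
def fockGen : ℕ → (Fock →L[ℂ] Fock)
  | 0 => vacProj
  | n + 1 => creation n.succPNat

end WeaklyMonotone

end

/-!
Any representation `π` of a C⋆-algebra generated by a family `t` satisfying `VacuumRel` is
isometric as soon as `π (t 0) ≠ 0`; this is proved by induction on `n` for the subalgebra `Cₙ`
generated by `t 0, …, t n`. Since `t (n + 1)` is an isometry `v` of the corner with unit `v* v`,
and its defect `v* v - v v*` is `tₙ* tₙ`, a unit of `Cₙ`, the step is a version of Coburn's theorem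
with coefficients in `Cₙ`. An element `x` of the algebra generated by `Cₙ` and `v` is a finite sum
of terms `vᵏ a v*ˡ`, where `a ∈ Cₙ` inside a box `max k l < L` and `a` is a multiple of `v* v` on
its border `max k l = L`. The coefficients are read off from compressions of `x`, so `π` controls
them, which gives `‖x‖ ≤ (L + 1)² ‖π x‖`. Applying this to the powers of `x* x` removes the factor.

The Fock representation does not kill `P_Ω`, the image of `s₀`, so it is isometric on the universal
algebra of `VacuumRel` and, since the quotient of a C⋆-algebra by a closed ideal is again a
C⋆-algebra, on `O_{A_ℕ} / J`.
-/

noncomputable section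

open Filter Topology

open scoped CStarAlgebra

namespace WeaklyMonotone

/-! ### Coburn's theorem with coefficients -/

section Growth

lemma le_of_pow_le_polynomial_mul_pow {a b : ℝ} (hb : 0 ≤ b) (d m : ℕ)
    (h : ∀ j : ℕ, a ^ 2 ^ j ≤ ((d * 2 ^ j : ℕ) + 1 : ℝ) ^ m * b ^ 2 ^ j) : a ≤ b := by
  by_contra! hlt
  rcases hb.eq_or_lt with rfl | hb
  · have := h 0
    simp only [pow_zero, pow_one, mul_zero] at this
    exact absurd this (not_le.2 hlt)
  have hratio : 1 < a / b := (one_lt_div hb).2 hlt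
  have hlim : Tendsto (fun j : ℕ => ((d : ℝ) + 1) ^ m *
      (((2 ^ j : ℕ) : ℝ) ^ m / (a / b) ^ 2 ^ j)) atTop (𝓝 0) := by
    have := ((tendsto_pow_const_div_const_pow_of_one_lt m hratio).comp
      (tendsto_pow_atTop_atTop_of_one_lt (α := ℕ) one_lt_two)).const_mul (((d : ℝ) + 1) ^ m)
    rwa [mul_zero] at this
  obtain ⟨j, hj⟩ := (hlim.eventually_lt_const one_pos).exists
  rw [← mul_div_assoc, ← mul_pow, div_lt_one (by positivity), div_pow,
    lt_div_iff₀ (by positivity)] at hj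
  refine absurd (h j) (not_le.2 (lt_of_le_of_lt ?_ hj))
  have : (1 : ℝ) ≤ 2 ^ j := one_le_pow₀ one_le_two
  gcongr
  push_cast
  linarith

variable {A : Type u} {B : Type v} [NonUnitalCStarAlgebra A] [NonUnitalCStarAlgebra B]

/-- Polynomial factors disappear on passing to the powers `(x* x) ^ 2 ^ j`, whose norms are
`‖x* x‖ ^ 2 ^ j`. -/
theorem norm_le_norm_map_of_polynomial_growth (π : A →⋆ₙₐ[ℂ] B) {M : ℕ → Set A} (m : ℕ)
    (hM_mul : ∀ {k l x y}, x ∈ M k → y ∈ M l → x * y ∈ M (k + l))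
    (hM_star : ∀ {k x}, x ∈ M k → star x ∈ M k)
    (hM_norm : ∀ {k x}, x ∈ M k → ‖x‖ ≤ ((k : ℝ) + 1) ^ m * ‖π x‖)
    {k : ℕ} {x : A} (hx : x ∈ M k) : ‖x‖ ≤ ‖π x‖ := by
  have hpow : ∀ j : ℕ, ∃ z ∈ M ((k + k) * 2 ^ j), IsSelfAdjoint z ∧
      ‖z‖ = ‖star x * x‖ ^ 2 ^ j ∧ ‖π z‖ = ‖π (star x * x)‖ ^ 2 ^ j := fun j => by
    induction j with
    | zero => exact ⟨star x * x, by simpa using hM_mul (hM_star hx) hx, .star_mul_self x,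
        by simp, by simp⟩
    | succ j ih =>
      obtain ⟨z, hz, hsa, hnorm, hnorm_map⟩ := ih
      refine ⟨z * z, ?_, ?_, ?_, ?_⟩
      · rw [pow_succ, ← mul_assoc, mul_two]
        exact hM_mul hz hz
      · rw [IsSelfAdjoint, star_mul, hsa.star_eq]
      · rw [hsa.norm_mul_self, hnorm, ← pow_mul, ← pow_succ]
      · rw [map_mul, (hsa.map π).norm_mul_self, hnorm_map, ← pow_mul, ← pow_succ]
  have hle : ‖star x * x‖ ≤ ‖π (star x * x)‖ :=
    le_of_pow_le_polynomial_mul_pow (norm_nonneg _) (k + k) m fun j => by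
      obtain ⟨z, hz, -, hnorm, hnorm_map⟩ := hpow j
      simpa only [hnorm, hnorm_map] using hM_norm hz
  rw [map_mul, map_star, CStarRing.norm_star_mul_self, CStarRing.norm_star_mul_self] at hle
  exact (mul_self_le_mul_self_iff (norm_nonneg _) (norm_nonneg _)).2 hle

lemma norm_smul_le_norm_map_smul (π : A →⋆ₙₐ[ℂ] B) {p e : A} (hp : IsStarProjection p)
    (hπp : π p ≠ 0) (he : ‖e‖ ≤ 1) (c : ℂ) : ‖c • e‖ ≤ ‖π (c • p)‖ := by
  have hone : 1 ≤ ‖π p‖ := by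
    have hsq : ‖π p‖ * 1 ≤ ‖π p‖ * ‖π p‖ := by
      rw [mul_one, ← sq, ← (hp.map π).isSelfAdjoint.norm_mul_self, (hp.map π).isIdempotentElem.eq]
    exact le_of_mul_le_mul_left hsq (norm_pos_iff.2 hπp)
  rw [map_smul, norm_smul, norm_smul]
  exact mul_le_mul_of_nonneg_left (he.trans hone) (norm_nonneg c)

end Growth

section CornerIsometry

/-- An isometry `v` of the corner `e D e`, where `e = v* v`. -/
structure IsCornerIsometry {D : Type v} [Mul D] [Star D] (v : D) : Prop where
  isPartialIsometry : v * star v * v = v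
  initial_mul : star v * v * v = v

variable {D : Type v} [NonUnitalRing D] [StarRing D]

/-- The powers `v ^ k` of an isometry of the corner with unit `e = v* v`; the `0`-th power
is `e`. -/
def cornerPow (v : D) : ℕ → D
  | 0 => star v * v
  | k + 1 => v * cornerPow v k

/-- The defect projection `v* v - v v*`. -/
def defect (v : D) : D := star v * v - v * star v

namespace IsCornerIsometry

variable {v : D} (hv : IsCornerIsometry v)
include hv

lemma mul_initial : v * (star v * v) = v := by
  rw [← mul_assoc, hv.isPartialIsometry]

lemma initial_mul_cornerPow (k : ℕ) : star v * v * cornerPow v k = cornerPow v k := by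
  cases k with
  | zero => rw [cornerPow, mul_assoc, hv.mul_initial]
  | succ k => rw [cornerPow, ← mul_assoc, hv.initial_mul]

lemma cornerPow_mul_cornerPow (k l : ℕ) :
    cornerPow v k * cornerPow v l = cornerPow v (k + l) := by
  induction k with
  | zero => rw [zero_add, cornerPow, hv.initial_mul_cornerPow]
  | succ k ih => rw [Nat.succ_add, cornerPow, mul_assoc, ih, cornerPow]

lemma star_cornerPow_mul_self (k : ℕ) : star (cornerPow v k) * cornerPow v k = star v * v := by
  induction k with
  | zero =>
    have := hv.initial_mul_cornerPow 0
    simpa only [cornerPow, star_mul, star_star] using this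
  | succ k ih =>
    rw [cornerPow, star_mul, mul_assoc, ← mul_assoc (star v), hv.initial_mul_cornerPow, ih]

lemma star_cornerPow_mul_cornerPow_add (k j : ℕ) :
    star (cornerPow v k) * cornerPow v (k + j) = cornerPow v j := by
  rw [← hv.cornerPow_mul_cornerPow, ← mul_assoc, hv.star_cornerPow_mul_self,
    hv.initial_mul_cornerPow]

lemma star_cornerPow_add_mul_cornerPow (k j : ℕ) :
    star (cornerPow v (k + j)) * cornerPow v k = star (cornerPow v j) := by
  rw [← hv.star_cornerPow_mul_cornerPow_add k j, star_mul, star_star]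

lemma defect_mul_self : defect v * v = 0 := by
  rw [defect, sub_mul, hv.initial_mul, hv.isPartialIsometry, sub_self]

lemma defect_mul_cornerPow_succ (k : ℕ) : defect v * cornerPow v (k + 1) = 0 := by
  rw [cornerPow, ← mul_assoc, hv.defect_mul_self, zero_mul]

lemma defect_mul_initial : defect v * (star v * v) = defect v := by
  have hstar : star v * (star v * v) = star v := by
    simpa only [star_mul, star_star, mul_assoc] using congrArg star hv.initial_mul
  rw [defect, sub_mul, mul_assoc, hv.mul_initial, mul_assoc v, hstar]

lemma isStarProjection_defect : IsStarProjection (defect v) where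
  isIdempotentElem := by
    rw [IsIdempotentElem, defect, mul_sub, ← defect, hv.defect_mul_initial, ← mul_assoc,
      hv.defect_mul_self, zero_mul, sub_zero]
  isSelfAdjoint := (IsSelfAdjoint.star_mul_self v).sub (IsSelfAdjoint.mul_star_self v)

end IsCornerIsometry

end CornerIsometry

section Toeplitz

variable {D : Type v} [NonUnitalRing D] [StarRing D] [Module ℂ D]

/-- The defect projection of the corner isometry `v` is the unit of the ⋆-algebra `S`; the
elements of `S` then serve as coefficients of ⋆-polynomials in `v`. -/
structure HasDefectUnit (v : D) (S : NonUnitalStarSubalgebra ℂ D) : Prop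
    extends IsCornerIsometry v where
  defect_mem : defect v ∈ S
  defect_mul : ∀ a ∈ S, defect v * a = a

/-- The monomials `v ^ k * a * star (v ^ l)`, with `a ∈ S`, of order less than `L` and the
monomials `v ^ k * star (v ^ l)` of order at most `L`. -/
inductive IsToeplitzMonomial (v : D) (S : NonUnitalStarSubalgebra ℂ D) (L : ℕ) : D → Prop
  | coeff {k l : ℕ} {a : D} (hk : k < L) (hl : l < L) (ha : a ∈ S) :
      IsToeplitzMonomial v S L (cornerPow v k * a * star (cornerPow v l))
  | shift {k l : ℕ} (hk : k ≤ L) (hl : l ≤ L) :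
      IsToeplitzMonomial v S L (cornerPow v k * star (cornerPow v l))

/-- The span of the Toeplitz monomials of level `L`; these subspaces filter the ⋆-algebra
generated by `v` and `S`. -/
def toeplitzLevel (v : D) (S : NonUnitalStarSubalgebra ℂ D) (L : ℕ) : Submodule ℂ D :=
  Submodule.span ℂ {x | IsToeplitzMonomial v S L x}

variable {v : D} {S : NonUnitalStarSubalgebra ℂ D} {L L' : ℕ} {a x y : D}

lemma IsToeplitzMonomial.mem_toeplitzLevel (hx : IsToeplitzMonomial v S L x) :
    x ∈ toeplitzLevel v S L :=
  Submodule.subset_span hx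

lemma IsToeplitzMonomial.mono (hx : IsToeplitzMonomial v S L x) (h : L ≤ L') :
    IsToeplitzMonomial v S L' x := by
  cases hx with
  | coeff hk hl ha => exact .coeff (hk.trans_le h) (hl.trans_le h) ha
  | shift hk hl => exact .shift (hk.trans h) (hl.trans h)

lemma toeplitzLevel_mono : Monotone (toeplitzLevel v S) := fun _ _ h =>
  Submodule.span_mono fun _ hx => IsToeplitzMonomial.mono hx h

lemma IsToeplitzMonomial.star (hx : IsToeplitzMonomial v S L x) :
    IsToeplitzMonomial v S L (star x) := by
  cases hx with
  | coeff hk hl ha =>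
    rw [star_mul, star_mul, star_star, ← mul_assoc]
    exact .coeff hl hk (star_mem ha)
  | shift hk hl =>
    rw [star_mul, star_star]
    exact .shift hl hk

lemma star_mem_toeplitzLevel [StarModule ℂ D] (hx : x ∈ toeplitzLevel v S L) :
    star x ∈ toeplitzLevel v S L := by
  induction hx using Submodule.span_induction with
  | mem x hx => exact hx.star.mem_toeplitzLevel
  | zero => rw [star_zero]; exact zero_mem _
  | add x y _ _ ihx ihy => rw [star_add]; exact add_mem ihx ihy
  | smul c x _ ih => rw [star_smul]; exact Submodule.smul_mem _ _ ih

namespace HasDefectUnit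

variable (h : HasDefectUnit v S)
include h

lemma mul_defect (ha : a ∈ S) : a * defect v = a := by
  have := congrArg star (h.defect_mul _ (star_mem ha))
  rwa [star_mul, star_star, h.isStarProjection_defect.isSelfAdjoint.star_eq] at this

lemma mul_cornerPow_succ (ha : a ∈ S) (k : ℕ) : a * cornerPow v (k + 1) = 0 := by
  rw [← h.mul_defect ha, mul_assoc, h.defect_mul_cornerPow_succ, mul_zero]

lemma mul_cornerPow_zero (ha : a ∈ S) : a * cornerPow v 0 = a := by
  rw [← h.mul_defect ha, mul_assoc, cornerPow, h.defect_mul_initial]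

lemma star_cornerPow_succ_mul (ha : a ∈ S) (k : ℕ) : star (cornerPow v (k + 1)) * a = 0 := by
  simpa only [star_mul, star_star, star_zero] using
    congrArg star (h.mul_cornerPow_succ (star_mem ha) k)

lemma cornerPow_zero_mul (ha : a ∈ S) : cornerPow v 0 * a = a := by
  simpa only [cornerPow, star_mul, star_star] using
    congrArg star (h.mul_cornerPow_zero (star_mem ha))

lemma mul_star_cornerPow_zero (ha : a ∈ S) : a * star (cornerPow v 0) = a := by
  simpa only [star_mul, star_star] using congrArg star (h.cornerPow_zero_mul (star_mem ha))

lemma coeff_mul_shift_mem (ha : a ∈ S) {k l k' l' : ℕ} (hk : k < L) (hl : l < L)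
    (hl' : l' ≤ L') :
    cornerPow v k * a * star (cornerPow v l) * (cornerPow v k' * star (cornerPow v l')) ∈
      toeplitzLevel v S (L + L') := by
  rw [mul_assoc _ (star _), ← mul_assoc (star _)]
  rcases le_or_gt k' l with hkl | hkl
  · obtain ⟨j, rfl⟩ := Nat.exists_eq_add_of_le hkl
    rw [h.star_cornerPow_add_mul_cornerPow, ← star_mul, h.cornerPow_mul_cornerPow]
    exact (IsToeplitzMonomial.coeff (by lia) (by lia) ha).mem_toeplitzLevel
  · obtain ⟨j, rfl⟩ := Nat.exists_eq_add_of_lt hkl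
    rw [add_assoc, h.star_cornerPow_mul_cornerPow_add, mul_assoc, ← mul_assoc a,
      h.mul_cornerPow_succ ha, zero_mul, mul_zero]
    exact zero_mem _

lemma coeff_mul_coeff_mem {a' : D} (ha : a ∈ S) (ha' : a' ∈ S) {k l k' l' : ℕ} (hk : k < L)
    (hl' : l' < L') :
    cornerPow v k * a * star (cornerPow v l) * (cornerPow v k' * a' * star (cornerPow v l')) ∈
      toeplitzLevel v S (L + L') := by
  rw [mul_assoc _ (star _), ← mul_assoc (star _), ← mul_assoc (star _)]
  rcases lt_trichotomy k' l with hkl | rfl | hkl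
  · obtain ⟨j, rfl⟩ := Nat.exists_eq_add_of_lt hkl
    rw [add_assoc, h.star_cornerPow_add_mul_cornerPow, h.star_cornerPow_succ_mul ha', zero_mul,
      mul_zero]
    exact zero_mem _
  · rw [h.star_cornerPow_mul_self, ← cornerPow, h.cornerPow_zero_mul ha', ← mul_assoc,
      mul_assoc _ a]
    exact (IsToeplitzMonomial.coeff (by lia) (by lia) (mul_mem ha ha')).mem_toeplitzLevel
  · obtain ⟨j, rfl⟩ := Nat.exists_eq_add_of_lt hkl
    rw [add_assoc, h.star_cornerPow_mul_cornerPow_add, mul_assoc (cornerPow v k), ← mul_assoc a,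
      ← mul_assoc a, h.mul_cornerPow_succ ha, zero_mul, zero_mul, mul_zero]
    exact zero_mem _

lemma shift_mul_shift_mem {k l k' l' : ℕ} (hk : k ≤ L) (hl : l ≤ L) (hk' : k' ≤ L')
    (hl' : l' ≤ L') :
    cornerPow v k * star (cornerPow v l) * (cornerPow v k' * star (cornerPow v l')) ∈
      toeplitzLevel v S (L + L') := by
  rw [mul_assoc, ← mul_assoc (star _)]
  rcases le_total k' l with hkl | hkl
  · obtain ⟨j, rfl⟩ := Nat.exists_eq_add_of_le hkl
    rw [h.star_cornerPow_add_mul_cornerPow, ← star_mul, h.cornerPow_mul_cornerPow]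
    exact (IsToeplitzMonomial.shift (by lia) (by lia)).mem_toeplitzLevel
  · obtain ⟨j, rfl⟩ := Nat.exists_eq_add_of_le hkl
    rw [h.star_cornerPow_mul_cornerPow_add, ← mul_assoc, h.cornerPow_mul_cornerPow]
    exact (IsToeplitzMonomial.shift (by lia) (by lia)).mem_toeplitzLevel

lemma monomial_mul_monomial_mem [StarModule ℂ D] (hx : IsToeplitzMonomial v S L x)
    (hy : IsToeplitzMonomial v S L' y) : x * y ∈ toeplitzLevel v S (L + L') := by
  cases hx with
  | coeff hk hl ha => cases hy with
    | coeff hk' hl' ha' => exact h.coeff_mul_coeff_mem ha ha' hk hl'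
    | shift hk' hl' => exact h.coeff_mul_shift_mem ha hk hl hl'
  | @shift k l hk hl => cases hy with
    | coeff hk' hl' ha' =>
      rw [add_comm]
      have := star_mem_toeplitzLevel (h.coeff_mul_shift_mem (k' := l) (star_mem ha') hl' hk' hk)
      simpa only [star_mul, star_star, mul_assoc] using this
    | shift hk' hl' => exact h.shift_mul_shift_mem hk hl hk' hl'

variable [IsScalarTower ℂ D D] [SMulCommClass ℂ D D] [StarModule ℂ D]

lemma mul_mem_toeplitzLevel (hx : x ∈ toeplitzLevel v S L) (hy : y ∈ toeplitzLevel v S L') :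
    x * y ∈ toeplitzLevel v S (L + L') := by
  have hle : Submodule.map₂ (LinearMap.mul ℂ D) (toeplitzLevel v S L) (toeplitzLevel v S L') ≤
      toeplitzLevel v S (L + L') := by
    rw [toeplitzLevel, toeplitzLevel, Submodule.map₂_span_span, Submodule.span_le]
    rintro _ ⟨x, hx, y, hy, rfl⟩
    exact h.monomial_mul_monomial_mem hx hy
  exact hle (Submodule.apply_mem_map₂ _ hx hy)

lemma exists_mem_toeplitzLevel (hx : x ∈ NonUnitalStarAlgebra.adjoin ℂ (insert v (S : Set D))) :
    ∃ L, x ∈ toeplitzLevel v S L := by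
  induction hx using NonUnitalStarAlgebra.adjoin_induction with
  | mem x hx =>
    refine ⟨1, ?_⟩
    rcases hx with rfl | hx
    · have hmem : cornerPow x 1 * star (cornerPow x 0) ∈ toeplitzLevel x S 1 :=
        (IsToeplitzMonomial.shift le_rfl zero_le_one).mem_toeplitzLevel
      simpa only [cornerPow, star_mul, star_star, h.mul_initial] using hmem
    · have hvx : cornerPow v 0 * x * star (cornerPow v 0) = x := by
        rw [h.cornerPow_zero_mul hx, h.mul_star_cornerPow_zero hx]
      exact hvx ▸ (IsToeplitzMonomial.coeff zero_lt_one zero_lt_one hx).mem_toeplitzLevel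
  | add x y _ _ ihx ihy =>
    obtain ⟨K, hK⟩ := ihx
    obtain ⟨L, hL⟩ := ihy
    exact ⟨max K L, add_mem (toeplitzLevel_mono (le_max_left K L) hK)
      (toeplitzLevel_mono (le_max_right K L) hL)⟩
  | zero => exact ⟨0, zero_mem _⟩
  | mul x y _ _ ihx ihy =>
    obtain ⟨K, hK⟩ := ihx
    obtain ⟨L, hL⟩ := ihy
    exact ⟨K + L, h.mul_mem_toeplitzLevel hK hL⟩
  | smul c x _ ih =>
    obtain ⟨L, hL⟩ := ih
    exact ⟨L, Submodule.smul_mem _ c hL⟩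
  | star x _ ih =>
    obtain ⟨L, hL⟩ := ih
    exact ⟨L, star_mem_toeplitzLevel hL⟩

end HasDefectUnit

end Toeplitz

section NormalForm

variable {D : Type v} [NonUnitalRing D] [StarRing D] [Module ℂ D] [IsScalarTower ℂ D D]
  [SMulCommClass ℂ D D]

/-- The linear map `a ↦ v ^ i.1 * a * star (v ^ i.2)`. -/
def toeplitzSandwich (v : D) (i : ℕ × ℕ) : D →ₗ[ℂ] D :=
  LinearMap.mulLeftRight ℂ (cornerPow v i.1, star (cornerPow v i.2))

/-- The coefficients allowed at position `i` in the normal form of an element of level `L`: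
elements of `S` below the border of the box `[0, L] × [0, L]` and scalars on it. -/
def toeplitzCoeff (v : D) (S : NonUnitalStarSubalgebra ℂ D) (L : ℕ) (i : ℕ × ℕ) :
    Submodule ℂ D :=
  if max i.1 i.2 < L then S.toNonUnitalSubalgebra.toSubmodule else Submodule.span ℂ {star v * v}

/-- The compression `p (v ^ k)* x v ^ l p`, where `p` is the defect projection of `v`. -/
def toeplitzEntry (v : D) (i : ℕ × ℕ) : D →ₗ[ℂ] D :=
  LinearMap.mulLeftRight ℂ (defect v * star (cornerPow v i.1), cornerPow v i.2 * defect v)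

variable {v : D} {S : NonUnitalStarSubalgebra ℂ D} {L : ℕ} {x y a c : D} {i j : ℕ × ℕ}

lemma IsCornerIsometry.shift_eq_add_shift_succ (hv : IsCornerIsometry v) (k l : ℕ) :
    cornerPow v k * star (cornerPow v l) = toeplitzSandwich v (k, l) (defect v) +
      cornerPow v (k + 1) * star (cornerPow v (l + 1)) := by
  have hone : cornerPow v 1 = v := by rw [cornerPow, cornerPow, hv.mul_initial]
  have hzero : ∀ n, cornerPow v n * (star v * v) = cornerPow v n := fun n =>
    hv.cornerPow_mul_cornerPow n 0
  rw [toeplitzSandwich, LinearMap.mulLeftRight_apply, defect, mul_sub, hzero,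
    ← hv.cornerPow_mul_cornerPow k 1, ← hv.cornerPow_mul_cornerPow l 1, hone, star_mul]
  noncomm_ring

namespace HasDefectUnit

variable (h : HasDefectUnit v S)
include h

lemma shift_mem_iSup (d : ℕ) {k l : ℕ} (hd : max k l + d = L) :
    cornerPow v k * star (cornerPow v l) ∈ ⨆ i ∈ Finset.range (L + 1) ×ˢ Finset.range (L + 1),
      (toeplitzCoeff v S L i).map (toeplitzSandwich v i) := by
  have hmem : (k, l) ∈ Finset.range (L + 1) ×ˢ Finset.range (L + 1) := by
    simp only [Finset.mem_product, Finset.mem_range]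
    lia
  induction d generalizing k l with
  | zero =>
    refine Submodule.mem_iSup_of_mem _ (Submodule.mem_iSup_of_mem hmem ⟨star v * v, ?_, ?_⟩)
    · rw [toeplitzCoeff, if_neg (by lia)]
      exact Submodule.mem_span_singleton_self _
    · rw [toeplitzSandwich, LinearMap.mulLeftRight_apply, ← cornerPow, h.cornerPow_mul_cornerPow,
        add_zero]
  | succ d ih =>
    rw [h.shift_eq_add_shift_succ]
    refine add_mem (Submodule.mem_iSup_of_mem _ (Submodule.mem_iSup_of_mem hmem
      ⟨defect v, ?_, rfl⟩)) (ih (by lia) ?_)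
    · rw [toeplitzCoeff, if_pos (by lia)]
      exact h.defect_mem
    · simp only [Finset.mem_product, Finset.mem_range]
      lia

lemma exists_eq_sum_of_mem_toeplitzLevel (hx : x ∈ toeplitzLevel v S L) :
    ∃ b : ℕ × ℕ → D, (∀ i, b i ∈ toeplitzCoeff v S L i) ∧
      x = ∑ i ∈ Finset.range (L + 1) ×ˢ Finset.range (L + 1), toeplitzSandwich v i (b i) := by
  have hle : toeplitzLevel v S L ≤ ⨆ i ∈ Finset.range (L + 1) ×ˢ Finset.range (L + 1),
      (toeplitzCoeff v S L i).map (toeplitzSandwich v i) := by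
    refine Submodule.span_le.2 ?_
    rintro _ (⟨hk, hl, ha⟩ | ⟨hk, hl⟩)
    · refine Submodule.mem_iSup_of_mem (_, _) (Submodule.mem_iSup_of_mem ?_ ⟨_, ?_, rfl⟩)
      · simp only [Finset.mem_product, Finset.mem_range]
        lia
      · rw [toeplitzCoeff, if_pos (max_lt hk hl)]
        exact ha
    · exact h.shift_mem_iSup _ (Nat.add_sub_of_le (max_le hk hl))
  obtain ⟨μ, hμ⟩ := (Submodule.mem_iSup_finset_iff_exists_sum _ x).1 (hle hx)
  choose b hb hbμ using fun i => (μ i).2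
  exact ⟨b, hb, by simp only [hbμ, hμ]⟩

end HasDefectUnit

lemma star_toeplitzEntry (hv : IsCornerIsometry v) (i : ℕ × ℕ) (x : D) :
    star (toeplitzEntry v i x) = toeplitzEntry v i.swap (star x) := by
  simp only [toeplitzEntry, LinearMap.mulLeftRight_apply, star_mul, star_star,
    hv.isStarProjection_defect.isSelfAdjoint.star_eq, mul_assoc, Prod.fst_swap, Prod.snd_swap]

lemma star_toeplitzSandwich (i : ℕ × ℕ) (x : D) :
    star (toeplitzSandwich v i x) = toeplitzSandwich v i.swap (star x) := by
  simp only [toeplitzSandwich, LinearMap.mulLeftRight_apply, star_mul, star_star, mul_assoc,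
    Prod.fst_swap, Prod.snd_swap]

lemma toeplitzEntry_toeplitzSandwich_self (hv : IsCornerIsometry v) (i : ℕ × ℕ) (c : D) :
    toeplitzEntry v i (toeplitzSandwich v i c) = defect v * c * defect v := by
  have hp : star v * v * defect v = defect v := by
    simpa only [star_mul, star_star, hv.isStarProjection_defect.isSelfAdjoint.star_eq] using
      congrArg star hv.defect_mul_initial
  calc toeplitzEntry v i (toeplitzSandwich v i c)
      = defect v * (star (cornerPow v i.1) * cornerPow v i.1) * c *
        ((star (cornerPow v i.2) * cornerPow v i.2) * defect v) := by
        simp only [toeplitzEntry, toeplitzSandwich, LinearMap.mulLeftRight_apply, mul_assoc]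
    _ = defect v * c * defect v := by
        rw [hv.star_cornerPow_mul_self, hv.star_cornerPow_mul_self, hv.defect_mul_initial, hp]

end NormalForm

section EntryBound

variable {D : Type v} [NonUnitalRing D] [StarRing D] [Module ℂ D] [IsScalarTower ℂ D D]
  [SMulCommClass ℂ D D] {v : D} {i j : ℕ × ℕ} {c : D}

namespace IsCornerIsometry

variable (hv : IsCornerIsometry v)
include hv

lemma toeplitzEntry_toeplitzSandwich_of_fst_lt (hij : j.1 < i.1) :
    toeplitzEntry v j (toeplitzSandwich v i c) = 0 := by
  obtain ⟨k, hk⟩ := Nat.exists_eq_add_of_lt hij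
  have hzero : defect v * (star (cornerPow v j.1) * cornerPow v i.1) = 0 := by
    rw [hk, add_assoc, hv.star_cornerPow_mul_cornerPow_add, hv.defect_mul_cornerPow_succ]
  calc toeplitzEntry v j (toeplitzSandwich v i c)
      = defect v * (star (cornerPow v j.1) * cornerPow v i.1) *
        (c * star (cornerPow v i.2) * (cornerPow v j.2 * defect v)) := by
        simp only [toeplitzEntry, toeplitzSandwich, LinearMap.mulLeftRight_apply, mul_assoc]
    _ = 0 := by rw [hzero, zero_mul]

lemma toeplitzEntry_toeplitzSandwich_of_snd_lt (hij : j.2 < i.2) :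
    toeplitzEntry v j (toeplitzSandwich v i c) = 0 := by
  rw [← star_eq_zero, star_toeplitzEntry hv, star_toeplitzSandwich]
  exact hv.toeplitzEntry_toeplitzSandwich_of_fst_lt hij

lemma toeplitzEntry_toeplitzSandwich_initial_of_fst_eq (hfst : i.1 = j.1) (hsnd : i.2 ≠ j.2) :
    toeplitzEntry v j (toeplitzSandwich v i (star v * v)) = 0 := by
  rcases hsnd.lt_or_gt with hlt | hlt
  · obtain ⟨k, hk⟩ := Nat.exists_eq_add_of_lt hlt
    have hzero : defect v * (star (cornerPow v i.2) * cornerPow v j.2) = 0 := by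
      rw [hk, add_assoc, hv.star_cornerPow_mul_cornerPow_add, hv.defect_mul_cornerPow_succ]
    calc toeplitzEntry v j (toeplitzSandwich v i (star v * v))
        = defect v * (star (cornerPow v j.1) * cornerPow v j.1) * (star v * v) *
          (star (cornerPow v i.2) * cornerPow v j.2) * defect v := by
          simp only [toeplitzEntry, toeplitzSandwich, LinearMap.mulLeftRight_apply, mul_assoc,
            hfst]
      _ = 0 := by
          rw [hv.star_cornerPow_mul_self, hv.defect_mul_initial, hv.defect_mul_initial, hzero,
            zero_mul]
  · exact hv.toeplitzEntry_toeplitzSandwich_of_snd_lt hlt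

lemma toeplitzEntry_toeplitzSandwich_initial_of_snd_eq (hfst : i.1 ≠ j.1) (hsnd : i.2 = j.2) :
    toeplitzEntry v j (toeplitzSandwich v i (star v * v)) = 0 := by
  rw [← star_eq_zero, star_toeplitzEntry hv, star_toeplitzSandwich, star_mul, star_star]
  exact hv.toeplitzEntry_toeplitzSandwich_initial_of_fst_eq hsnd hfst

end IsCornerIsometry

namespace HasDefectUnit

variable {S : NonUnitalStarSubalgebra ℂ D} {L : ℕ} {x : D} (h : HasDefectUnit v S)
include h

lemma toeplitzEntry_toeplitzSandwich_of_lt_fst (hc : c ∈ S) (hij : i.1 < j.1) :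
    toeplitzEntry v j (toeplitzSandwich v i c) = 0 := by
  obtain ⟨k, hk⟩ := Nat.exists_eq_add_of_lt hij
  have hzero : star (cornerPow v j.1) * cornerPow v i.1 * c = 0 := by
    rw [hk, add_assoc, h.star_cornerPow_add_mul_cornerPow, h.star_cornerPow_succ_mul hc]
  calc toeplitzEntry v j (toeplitzSandwich v i c)
      = defect v * (star (cornerPow v j.1) * cornerPow v i.1 * c) *
        (star (cornerPow v i.2) * (cornerPow v j.2 * defect v)) := by
        simp only [toeplitzEntry, toeplitzSandwich, LinearMap.mulLeftRight_apply, mul_assoc]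
    _ = 0 := by rw [hzero, mul_zero, zero_mul]

lemma toeplitzEntry_toeplitzSandwich_of_lt_snd (hc : c ∈ S) (hij : i.2 < j.2) :
    toeplitzEntry v j (toeplitzSandwich v i c) = 0 := by
  rw [← star_eq_zero, star_toeplitzEntry h.toIsCornerIsometry, star_toeplitzSandwich]
  exact h.toeplitzEntry_toeplitzSandwich_of_lt_fst (star_mem hc) hij

lemma toeplitzEntry_toeplitzSandwich_of_ne (hc : c ∈ toeplitzCoeff v S L i) (hij : i ≠ j)
    (hj : max j.1 j.2 ≤ L) : toeplitzEntry v j (toeplitzSandwich v i c) = 0 := by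
  rw [Ne, Prod.ext_iff, not_and_or] at hij
  rw [toeplitzCoeff] at hc
  split_ifs at hc with hi
  · rcases hij with hne | hne <;> rcases Ne.lt_or_gt hne with hlt | hlt
    · exact h.toeplitzEntry_toeplitzSandwich_of_lt_fst hc hlt
    · exact h.toeplitzEntry_toeplitzSandwich_of_fst_lt hlt
    · exact h.toeplitzEntry_toeplitzSandwich_of_lt_snd hc hlt
    · exact h.toeplitzEntry_toeplitzSandwich_of_snd_lt hlt
  · by_cases hfst : j.1 < i.1
    · exact h.toeplitzEntry_toeplitzSandwich_of_fst_lt hfst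
    by_cases hsnd : j.2 < i.2
    · exact h.toeplitzEntry_toeplitzSandwich_of_snd_lt hsnd
    obtain ⟨z, rfl⟩ := Submodule.mem_span_singleton.1 hc
    rw [map_smul, map_smul]
    have hborder : i.1 = j.1 ∨ i.2 = j.2 := by lia
    rcases hborder with heq | heq
    · rw [h.toeplitzEntry_toeplitzSandwich_initial_of_fst_eq heq (by lia), smul_zero]
    · rw [h.toeplitzEntry_toeplitzSandwich_initial_of_snd_eq (by lia) heq, smul_zero]

lemma toeplitzEntry_sum {b : ℕ × ℕ → D} (hb : ∀ i, b i ∈ toeplitzCoeff v S L i)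
    (hj : j ∈ Finset.range (L + 1) ×ˢ Finset.range (L + 1)) :
    toeplitzEntry v j (∑ i ∈ Finset.range (L + 1) ×ˢ Finset.range (L + 1),
      toeplitzSandwich v i (b i)) = defect v * b j * defect v := by
  have hjL : max j.1 j.2 ≤ L := by
    simp only [Finset.mem_product, Finset.mem_range] at hj
    lia
  rw [map_sum, Finset.sum_eq_single_of_mem j hj fun i _ hij =>
    h.toeplitzEntry_toeplitzSandwich_of_ne (hb i) hij hjL,
    toeplitzEntry_toeplitzSandwich_self h.toIsCornerIsometry]

end HasDefectUnit

end EntryBound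

section Coburn

variable {A : Type u} {B : Type v} [NonUnitalCStarAlgebra A] [NonUnitalCStarAlgebra B] {v : A}

namespace IsCornerIsometry

variable (hv : IsCornerIsometry v)
include hv

lemma norm_cornerPow_le_one (k : ℕ) : ‖cornerPow v k‖ ≤ 1 := by
  refine norm_le_one_of_partialIsometry ?_
  rw [mul_assoc, hv.star_cornerPow_mul_self]
  exact hv.cornerPow_mul_cornerPow k 0

lemma norm_toeplitzSandwich_le (i : ℕ × ℕ) (c : A) : ‖toeplitzSandwich v i c‖ ≤ ‖c‖ := by
  rw [toeplitzSandwich, LinearMap.mulLeftRight_apply]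
  calc ‖cornerPow v i.1 * c * star (cornerPow v i.2)‖
      ≤ ‖cornerPow v i.1‖ * ‖c‖ * ‖star (cornerPow v i.2)‖ := norm_mul₃_le
    _ ≤ 1 * ‖c‖ * 1 := by
        rw [norm_star]
        gcongr <;> exact hv.norm_cornerPow_le_one _
    _ = ‖c‖ := by rw [one_mul, mul_one]

lemma norm_map_toeplitzEntry_le (π : A →⋆ₙₐ[ℂ] B) (i : ℕ × ℕ) (x : A) :
    ‖π (toeplitzEntry v i x)‖ ≤ ‖π x‖ := by
  have hp : ‖defect v‖ ≤ 1 := hv.isStarProjection_defect.norm_le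
  have hleft : ‖defect v * star (cornerPow v i.1)‖ ≤ 1 := by
    refine (norm_mul_le _ _).trans (mul_le_one₀ hp (norm_nonneg _) ?_)
    rw [norm_star]
    exact hv.norm_cornerPow_le_one _
  have hright : ‖cornerPow v i.2 * defect v‖ ≤ 1 :=
    (norm_mul_le _ _).trans (mul_le_one₀ (hv.norm_cornerPow_le_one _) (norm_nonneg _) hp)
  rw [toeplitzEntry, LinearMap.mulLeftRight_apply, map_mul, map_mul]
  calc ‖π (defect v * star (cornerPow v i.1)) * π x * π (cornerPow v i.2 * defect v)‖
      ≤ ‖π (defect v * star (cornerPow v i.1))‖ * ‖π x‖ *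
        ‖π (cornerPow v i.2 * defect v)‖ := norm_mul₃_le
    _ ≤ 1 * ‖π x‖ * 1 := by
        gcongr
        · exact (NonUnitalStarAlgHom.norm_apply_le π _).trans hleft
        · exact (NonUnitalStarAlgHom.norm_apply_le π _).trans hright
    _ = ‖π x‖ := by rw [one_mul, mul_one]

end IsCornerIsometry

namespace HasDefectUnit

variable {S : NonUnitalStarSubalgebra ℂ A} {L : ℕ} {x : A} (h : HasDefectUnit v S)
  (hp : defect v ≠ 0) (π : A →⋆ₙₐ[ℂ] B) (hπ : ∀ a ∈ S, ‖a‖ ≤ ‖π a‖)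
include h hp hπ

lemma norm_le_norm_map_defect_mul_mul_defect {i : ℕ × ℕ} {c : A}
    (hc : c ∈ toeplitzCoeff v S L i) : ‖c‖ ≤ ‖π (defect v * c * defect v)‖ := by
  rw [toeplitzCoeff] at hc
  split_ifs at hc
  · rw [h.defect_mul c hc, h.mul_defect hc]
    exact hπ c hc
  · obtain ⟨z, rfl⟩ := Submodule.mem_span_singleton.1 hc
    rw [mul_smul_comm, smul_mul_assoc, h.defect_mul_initial,
      h.isStarProjection_defect.isIdempotentElem.eq]
    have hπp : π (defect v) ≠ 0 := fun hzero =>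
      hp (norm_le_zero_iff.1 ((hπ _ h.defect_mem).trans_eq (by rw [hzero, norm_zero])))
    exact norm_smul_le_norm_map_smul π h.isStarProjection_defect hπp
      (h.norm_cornerPow_le_one 0) z

lemma norm_le_of_mem_toeplitzLevel (hx : x ∈ toeplitzLevel v S L) :
    ‖x‖ ≤ ((L : ℝ) + 1) ^ 2 * ‖π x‖ := by
  obtain ⟨b, hb, rfl⟩ := h.exists_eq_sum_of_mem_toeplitzLevel hx
  set box := Finset.range (L + 1) ×ˢ Finset.range (L + 1) with hbox
  set x := ∑ i ∈ box, toeplitzSandwich v i (b i)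
  have hb_norm : ∀ i ∈ box, ‖b i‖ ≤ ‖π x‖ := fun i hi => by
    calc ‖b i‖ ≤ ‖π (defect v * b i * defect v)‖ :=
          h.norm_le_norm_map_defect_mul_mul_defect hp π hπ (hb i)
      _ = ‖π (toeplitzEntry v i x)‖ := by rw [h.toeplitzEntry_sum hb hi]
      _ ≤ ‖π x‖ := h.norm_map_toeplitzEntry_le π i x
  calc ‖x‖ ≤ box.card • ‖π x‖ := (norm_sum_le _ _).trans <| Finset.sum_le_card_nsmul _ _ _
        fun i hi => (h.norm_toeplitzSandwich_le i _).trans (hb_norm i hi)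
    _ = ((L : ℝ) + 1) ^ 2 * ‖π x‖ := by
        rw [hbox, Finset.card_product, Finset.card_range, nsmul_eq_mul, sq]
        push_cast
        rfl

theorem norm_le_norm_map (hx : x ∈ NonUnitalStarAlgebra.adjoin ℂ (insert v (S : Set A))) :
    ‖x‖ ≤ ‖π x‖ := by
  obtain ⟨L, hL⟩ := h.exists_mem_toeplitzLevel hx
  exact norm_le_norm_map_of_polynomial_growth π (M := fun L => toeplitzLevel v S L) 2
    h.mul_mem_toeplitzLevel star_mem_toeplitzLevel (h.norm_le_of_mem_toeplitzLevel hp π hπ) hL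

end HasDefectUnit

end Coburn

section Adjoin

variable {D : Type v} [NonUnitalRing D] [StarRing D] [Module ℂ D] [IsScalarTower ℂ D D]
  [SMulCommClass ℂ D D] [StarModule ℂ D]

lemma exists_eq_smul_of_mem_adjoin_singleton {p x : D} (hp : IsStarProjection p)
    (hx : x ∈ NonUnitalStarAlgebra.adjoin ℂ {p}) : ∃ c : ℂ, x = c • p := by
  induction hx using NonUnitalStarAlgebra.adjoin_induction with
  | mem x hx => exact ⟨1, by rw [Set.mem_singleton_iff.1 hx, one_smul]⟩
  | add x y _ _ ihx ihy =>
    obtain ⟨a, rfl⟩ := ihx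
    obtain ⟨b, rfl⟩ := ihy
    exact ⟨a + b, (add_smul a b p).symm⟩
  | zero => exact ⟨0, (zero_smul ℂ p).symm⟩
  | mul x y _ _ ihx ihy =>
    obtain ⟨a, rfl⟩ := ihx
    obtain ⟨b, rfl⟩ := ihy
    exact ⟨a * b, by rw [smul_mul_smul_comm, hp.isIdempotentElem.eq]⟩
  | smul c x _ ih =>
    obtain ⟨a, rfl⟩ := ih
    exact ⟨c * a, smul_smul c a p⟩
  | star x _ ih =>
    obtain ⟨a, rfl⟩ := ih
    exact ⟨star a, by rw [star_smul, hp.isSelfAdjoint.star_eq]⟩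

lemma exists_mem_adjoin_image {t : ℕ → D} {x : D}
    (hx : x ∈ NonUnitalStarAlgebra.adjoin ℂ (Set.range t)) :
    ∃ n, x ∈ NonUnitalStarAlgebra.adjoin ℂ (t '' Set.Iic n) := by
  have hmono : Monotone fun n => NonUnitalStarAlgebra.adjoin ℂ (t '' Set.Iic n) := fun _ _ h =>
    NonUnitalStarAlgebra.adjoin_mono (Set.image_mono (Set.Iic_subset_Iic.2 h))
  have hrange : Set.range t = ⋃ n, t '' Set.Iic n := by
    rw [← Set.image_iUnion, Set.iUnion_Iic, Set.image_univ]
  have hsup : NonUnitalStarAlgebra.adjoin ℂ (⋃ n, t '' Set.Iic n) =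
      ⨆ n, NonUnitalStarAlgebra.adjoin ℂ (t '' Set.Iic n) := NonUnitalStarAlgebra.gc.l_iSup
  rw [hrange, hsup, ← SetLike.mem_coe,
    NonUnitalStarSubalgebra.coe_iSup_of_directed hmono.directed_le] at hx
  exact Set.mem_iUnion.1 hx

end Adjoin

section Uniqueness

variable {A : Type u} {B : Type v} [NonUnitalCStarAlgebra A] [NonUnitalCStarAlgebra B] {t : ℕ → A}

namespace MonotoneRel

lemma initial_mul (ht : MonotoneRel t) {k n : ℕ} (h : k ≤ n) : star (t n) * t n * t k = t k := by
  have hother : ∀ j ∈ Finset.range (n + 1), j ≠ k → t j * star (t j) * t k = 0 := fun j _ hj => by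
    rw [mul_assoc, ht.orthogonal j k hj, mul_zero]
  rw [ht.sum_range, Finset.sum_mul,
    Finset.sum_eq_single_of_mem k (Finset.mem_range_succ_iff.2 h) hother, ht.partialIsometry]

lemma initial_mul_initial (ht : MonotoneRel t) {k n : ℕ} (h : k ≤ n) :
    star (t k) * t k * (star (t n) * t n) = star (t k) * t k := by
  rw [ht.sum_range k, Finset.sum_mul]
  refine Finset.sum_congr rfl fun j hj => ?_
  have hjn : star (t j) * (star (t n) * t n) = star (t j) := by
    simpa only [star_mul, star_star, mul_assoc] using
      congrArg star (ht.initial_mul ((Finset.mem_range_succ_iff.1 hj).trans h))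
  rw [mul_assoc, hjn]

lemma mul_initial (ht : MonotoneRel t) {k n : ℕ} (h : k ≤ n) : t k * (star (t n) * t n) = t k := by
  nth_rw 1 [← ht.partialIsometry k, mul_assoc (t k), mul_assoc (t k), ht.initial_mul_initial h,
    ← mul_assoc, ht.partialIsometry]

lemma initial_mul_of_mem_adjoin (ht : MonotoneRel t) {n : ℕ} {x : A}
    (hx : x ∈ NonUnitalStarAlgebra.adjoin ℂ (t '' Set.Iic n)) : star (t n) * t n * x = x := by
  suffices star (t n) * t n * x = x ∧ x * (star (t n) * t n) = x from this.1
  induction hx using NonUnitalStarAlgebra.adjoin_induction with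
  | mem x hx =>
    obtain ⟨k, hk, rfl⟩ := hx
    exact ⟨ht.initial_mul hk, ht.mul_initial hk⟩
  | add x y _ _ ihx ihy => exact ⟨by rw [mul_add, ihx.1, ihy.1], by rw [add_mul, ihx.2, ihy.2]⟩
  | zero => exact ⟨mul_zero _, zero_mul _⟩
  | mul x y _ _ ihx ihy => exact ⟨by rw [← mul_assoc, ihx.1], by rw [mul_assoc, ihy.2]⟩
  | smul c x _ ih => exact ⟨by rw [mul_smul_comm, ih.1], by rw [smul_mul_assoc, ih.2]⟩
  | star x _ ih =>
    constructor
    · simpa only [star_mul, star_star] using congrArg star ih.2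
    · simpa only [star_mul, star_star] using congrArg star ih.1

lemma defect_succ (ht : MonotoneRel t) (n : ℕ) : defect (t (n + 1)) = star (t n) * t n := by
  rw [defect, ht.sum_range (n + 1), Finset.sum_range_succ, ← ht.sum_range n, add_sub_cancel_right]

lemma hasDefectUnit (ht : MonotoneRel t) (n : ℕ) :
    HasDefectUnit (t (n + 1)) (NonUnitalStarAlgebra.adjoin ℂ (t '' Set.Iic n)) where
  isPartialIsometry := ht.partialIsometry _
  initial_mul := ht.initial_mul le_rfl
  defect_mem := by
    have hn : t n ∈ NonUnitalStarAlgebra.adjoin ℂ (t '' Set.Iic n) :=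
      NonUnitalStarAlgebra.subset_adjoin ℂ _ ⟨n, Set.mem_Iic.2 le_rfl, rfl⟩
    rw [ht.defect_succ]
    exact mul_mem (star_mem hn) hn
  defect_mul a ha := by rw [ht.defect_succ, ht.initial_mul_of_mem_adjoin ha]

end MonotoneRel

lemma VacuumRel.isStarProjection_zero (ht : VacuumRel t) : IsStarProjection (t 0) := by
  have hsa : star (t 0) = t 0 := by rw [ht.vacuum, star_mul, star_star]
  exact ⟨by rw [IsIdempotentElem]; nth_rw 2 [← hsa]; exact ht.vacuum.symm, hsa⟩

namespace VacuumRel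

variable (ht : VacuumRel t) (π : A →⋆ₙₐ[ℂ] B) (hπ : π (t 0) ≠ 0)
include ht hπ

lemma norm_le_norm_map_of_mem_adjoin_image {n : ℕ} {x : A}
    (hx : x ∈ NonUnitalStarAlgebra.adjoin ℂ (t '' Set.Iic n)) : ‖x‖ ≤ ‖π x‖ := by
  induction n generalizing x with
  | zero =>
    have hIic : Set.Iic (0 : ℕ) = {0} := Set.Iic_bot
    rw [hIic, Set.image_singleton] at hx
    obtain ⟨c, rfl⟩ := exists_eq_smul_of_mem_adjoin_singleton ht.isStarProjection_zero hx
    exact norm_smul_le_norm_map_smul π ht.isStarProjection_zero hπ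
      ht.isStarProjection_zero.norm_le c
  | succ n ih =>
    have hdefect : defect (t (n + 1)) ≠ 0 := fun hzero => hπ <| by
      rw [ht.defect_succ] at hzero
      rw [← ht.initial_mul n.zero_le, hzero, zero_mul, map_zero]
    refine (ht.hasDefectUnit n).norm_le_norm_map hdefect π (fun a ha => ih ha)
      (NonUnitalStarAlgebra.adjoin_mono ?_ hx)
    rw [← Order.succ_eq_add_one, Order.Iic_succ, Set.image_insert_eq]
    exact Set.insert_subset_insert (NonUnitalStarAlgebra.subset_adjoin ℂ _)

theorem norm_map_eq (hdense : Dense (NonUnitalStarAlgebra.adjoin ℂ (Set.range t) : Set A))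
    (x : A) : ‖π x‖ = ‖x‖ := by
  refine le_antisymm (NonUnitalStarAlgHom.norm_apply_le π x) ?_
  refine hdense.induction (P := fun x => ‖x‖ ≤ ‖π x‖) (fun x hx => ?_)
    (isClosed_le continuous_norm (map_continuous π).norm) x
  obtain ⟨n, hn⟩ := exists_mem_adjoin_image hx
  exact ht.norm_le_norm_map_of_mem_adjoin_image π hπ hn

end VacuumRel

end Uniqueness

/-! ### The quotient of a C⋆-algebra by a closed ideal is a C⋆-algebra -/

section Quotient

variable {A : Type v} [NonUnitalCStarAlgebra A]

lemma norm_sub_star_mul_self_mul_le {b : A} (hb : ‖star b * b‖ ≤ 1) (z : A) :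
    ‖z - star b * b * z‖ ≤ ‖z‖ := by
  let := CStarAlgebra.spectralOrder A
  have := CStarAlgebra.spectralOrderedRing A
  refine CStarAlgebra.norm_sub_mul_self_le_of_inr z le_rfl (star_mul_self_nonneg b) hb
    (norm_nonneg z) ?_
  rw [Unitization.inr_zero, sub_zero, mul_one, CStarRing.norm_star_mul_self,
    Unitization.norm_inr, sq]

lemma norm_sub_mul_star_mul_self_le {b : A} (hb : ‖star b * b‖ ≤ 1) (z : A) :
    ‖z - z * (star b * b)‖ ≤ ‖z‖ := by
  rw [← norm_star, ← norm_star z]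
  simpa only [star_sub, star_mul, star_star] using norm_sub_star_mul_self_mul_le hb (star z)

namespace CStarIdeal

/-- A closed ideal as a C⋆-subalgebra. -/
def toSubalgebra (I : CStarIdeal A) : NonUnitalStarSubalgebra ℂ A where
  carrier := I.carrier
  add_mem' := add_mem
  zero_mem' := zero_mem _
  mul_mem' _ hb := I.isClosedIdeal.mul_left _ _ hb
  smul_mem' c _ hx := I.carrier.smul_mem c hx
  star_mem' hx := I.star_mem _ hx

instance (I : CStarIdeal A) : IsClosed (I.toSubalgebra : Set A) := I.isClosedIdeal.closed

lemma exists_approx_unit (I : CStarIdeal A) {y : A} (hy : y ∈ I.carrier) {ε : ℝ} (hε : 0 < ε) :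
    ∃ b : A, star b * b ∈ I.carrier ∧ ‖star b * b‖ ≤ 1 ∧ ‖y - y * (star b * b)‖ < ε := by
  let := CStarAlgebra.spectralOrder I.toSubalgebra
  have := CStarAlgebra.spectralOrderedRing I.toSubalgebra
  have hunit := CStarAlgebra.increasingApproximateUnit I.toSubalgebra
  have := hunit.neBot
  have hclose := Metric.tendsto_nhds.1 (hunit.tendsto_mul_left ⟨y, hy⟩) ε hε
  obtain ⟨e, he, he_nonneg, he_norm⟩ :=
    (hclose.and (hunit.eventually_nonneg.and hunit.eventually_norm)).exists
  obtain ⟨b, rfl⟩ := CStarAlgebra.nonneg_iff_eq_star_mul_self.1 he_nonneg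
  refine ⟨b, (star b * b).2, he_norm, ?_⟩
  rw [dist_comm, dist_eq_norm] at he
  exact he

lemma norm_toQuot_mul_self_le (I : CStarIdeal A) (x : A) {y : A} (hy : y ∈ I.carrier) :
    ‖I.toQuot x‖ * ‖I.toQuot x‖ ≤ ‖star x * x + y‖ := by
  refine le_of_forall_pos_lt_add fun ε hε => ?_
  obtain ⟨b, hbI, hb_norm, hyb⟩ := I.exists_approx_unit hy hε
  set e := star b * b with he
  have he_star : star e = e := by rw [he, star_mul, star_star]
  have hquot : I.toQuot x = I.toQuot (x - x * e) := by
    rw [mk_eq_mk, sub_sub_cancel]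
    exact I.isClosedIdeal.mul_left _ _ hbI
  set a := star x * x with ha
  have hexpand : star (x - x * e) * (x - x * e) = (a - a * e) - e * (a - a * e) := by
    rw [star_sub, star_mul, he_star, ha]
    noncomm_ring
  have hsplit : a - a * e = ((a + y) - (a + y) * e) - (y - y * e) := by
    rw [add_mul]
    abel
  calc ‖I.toQuot x‖ * ‖I.toQuot x‖ ≤ ‖x - x * e‖ * ‖x - x * e‖ := by
        rw [hquot]
        exact mul_self_le_mul_self (norm_nonneg _) (norm_mk_le _)
    _ = ‖(a - a * e) - e * (a - a * e)‖ := by rw [← CStarRing.norm_star_mul_self, hexpand]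
    _ ≤ ‖a - a * e‖ := norm_sub_star_mul_self_mul_le hb_norm _
    _ ≤ ‖(a + y) - (a + y) * e‖ + ‖y - y * e‖ := by
        rw [hsplit]
        exact norm_sub_le _ _
    _ < ‖a + y‖ + ε := add_lt_add_of_le_of_lt (norm_sub_mul_star_mul_self_le hb_norm _) hyb

variable {I : CStarIdeal A}

instance : CStarRing I.Quot where
  norm_mul_self_le q := by
    obtain ⟨x, rfl⟩ := mk_surjective q
    rw [← mk_star, ← mk_mul]
    refine le_of_forall_pos_le_add fun ε hε => ?_
    obtain ⟨z, hz, hlt⟩ := norm_mk_lt (I.toQuot (star x * x)) hε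
    have := norm_toQuot_mul_self_le I x (mk_eq_mk.1 hz)
    rw [add_sub_cancel] at this
    exact this.trans hlt.le

instance : NonUnitalCStarAlgebra I.Quot where
  smul_assoc c a b := by
    obtain ⟨a, rfl⟩ := mk_surjective a
    obtain ⟨b, rfl⟩ := mk_surjective b
    simp only [smul_eq_mul, ← map_smul, ← mk_mul, smul_mul_assoc]
  smul_comm c a b := by
    obtain ⟨a, rfl⟩ := mk_surjective a
    obtain ⟨b, rfl⟩ := mk_surjective b
    simp only [smul_eq_mul, ← map_smul, ← mk_mul, mul_smul_comm]
  star_smul c a := by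
    obtain ⟨a, rfl⟩ := mk_surjective a
    simp only [← map_smul, ← mk_star, star_smul]

variable (I) in
/-- The quotient map as a ⋆-homomorphism. -/
def quotHom : A →⋆ₙₐ[ℂ] I.Quot where
  toFun := I.toQuot
  map_smul' := map_smul I.toQuot
  map_zero' := map_zero I.toQuot
  map_add' := map_add I.toQuot
  map_mul' := mk_mul
  map_star' := mk_star

/-- The factorization through the quotient of a ⋆-homomorphism vanishing on the ideal. -/
def quotLift {B : Type u} [NonUnitalCStarAlgebra B] (φ : A →⋆ₙₐ[ℂ] B)
    (h : ∀ x ∈ I.carrier, φ x = 0) : I.Quot →⋆ₙₐ[ℂ] B :=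
  let f : I.Quot →ₗ[ℂ] B := I.carrier.liftQ (φ : A →ₗ[ℂ] B) h
  { toFun := f
    map_smul' := map_smul f
    map_zero' := map_zero f
    map_add' := map_add f
    map_mul' := fun a b => by
      obtain ⟨a, rfl⟩ := mk_surjective a
      obtain ⟨b, rfl⟩ := mk_surjective b
      exact map_mul φ a b
    map_star' := fun a => by
      obtain ⟨a, rfl⟩ := mk_surjective a
      exact map_star φ a }

end CStarIdeal

end Quotient

/-! ### The Fock representation -/

section Fock

lemma inner_basisVec_left (γ : Word) (f : Fock) : inner ℂ (basisVec γ) f = f γ := by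
  classical
  have hsingle := lp.inner_single_left (𝕜 := ℂ) (G := fun _ : Word => ℂ) γ 1 f
  rw [RCLike.inner_apply, map_one, mul_one] at hsingle
  rw [← hsingle, basisVec]

lemma norm_basisVec (γ : Word) : ‖basisVec γ‖ = 1 := by
  rw [norm_eq_sqrt_re_inner (𝕜 := ℂ), inner_basisVec_left, basisVec_self, RCLike.one_re,
    Real.sqrt_one]

lemma ext_basisVec {S T : Fock →L[ℂ] Fock} (h : ∀ γ, S (basisVec γ) = T (basisVec γ)) : S = T := by
  classical
  refine lp.ext_continuousLinearMap (by norm_num) fun γ => ?_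
  ext1
  have hγ : lp.singleContinuousLinearMap ℂ (fun _ : Word => ℂ) 2 γ 1 = basisVec γ := by
    rw [basisVec]
    rfl
  rw [ContinuousLinearMap.comp_apply, ContinuousLinearMap.comp_apply, hγ, h γ]

lemma annihilation_apply (i : ℕ+) (f : Fock) (γ : Word) :
    annihilation i f γ = inner ℂ (creation i (basisVec γ)) f := by
  rw [← inner_basisVec_left, annihilation, ContinuousLinearMap.adjoint_inner_right]

lemma annihilation_vac (i : ℕ+) : annihilation i vac = 0 := by
  classical
  ext γ
  rw [annihilation_apply, creation_basisVec]
  split_ifs with h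
  · rw [inner_basisVec_left, vac, basisVec_ne (by simp)]
    rfl
  · rw [inner_zero_left]
    rfl

lemma annihilation_cons_of_ne {i j : ℕ+} (hij : j ≠ i) (l : List ℕ+)
    (h : (j :: l).IsChain (· ≥ ·)) : annihilation i (basisVec ⟨j :: l, h⟩) = 0 := by
  classical
  ext γ
  rw [annihilation_apply, creation_basisVec]
  split_ifs with hγ
  · rw [inner_basisVec_left, basisVec_ne]
    · rfl
    · exact fun heq => hij (List.cons.inj (congrArg Subtype.val heq)).1.symm
  · rw [inner_zero_left]
    rfl

lemma annihilation_cons_self (i : ℕ+) (l : List ℕ+) (h : (i :: l).IsChain (· ≥ ·)) :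
    annihilation i (basisVec ⟨i :: l, h⟩) = basisVec ⟨l, h.tail⟩ := by
  classical
  ext γ
  rw [annihilation_apply, creation_basisVec]
  by_cases hγ : γ = ⟨l, h.tail⟩
  · subst hγ
    rw [dif_pos (List.isChain_cons.1 h).1, inner_basisVec_left, basisVec_self, basisVec_self]
  · rw [basisVec_ne hγ]
    split_ifs with hhead
    · rw [inner_basisVec_left, basisVec_ne]
      exact fun heq => hγ (Subtype.ext (List.cons.inj (congrArg Subtype.val heq)).2)
    · rw [inner_zero_left]

lemma vacProj_apply (f : Fock) : vacProj f = f ⟨[], List.isChain_nil⟩ • vac := by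
  have hvac : ‖vac‖ = 1 := norm_basisVec _
  rw [vacProj, Submodule.starProjection_unit_singleton ℂ hvac f, ← inner_basisVec_left]
  rfl

lemma vacProj_vac : vacProj vac = vac := by
  rw [vacProj_apply, vac, basisVec_self, one_smul]

lemma vacProj_cons (j : ℕ+) (l : List ℕ+) (h : (j :: l).IsChain (· ≥ ·)) :
    vacProj (basisVec ⟨j :: l, h⟩) = 0 := by
  rw [vacProj_apply, basisVec_ne (by simp), zero_smul]

lemma vacProj_ne_zero : vacProj ≠ 0 := fun hzero => by
  have hvac : ‖vac‖ = 1 := norm_basisVec _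
  rw [← vacProj_vac, hzero, zero_apply, norm_zero] at hvac
  exact zero_ne_one hvac

lemma isStarProjection_vacProj : IsStarProjection vacProj :=
  isStarProjection_starProjection

lemma star_creation (i : ℕ+) : star (creation i) = annihilation i := rfl

lemma creation_annihilation_cons (i j : ℕ+) (l : List ℕ+) (h : (j :: l).IsChain (· ≥ ·)) :
    creation i (annihilation i (basisVec ⟨j :: l, h⟩)) =
      if j = i then basisVec ⟨j :: l, h⟩ else 0 := by
  split_ifs with hj
  · subst hj
    rw [annihilation_cons_self, creation_basisVec, dif_pos (List.isChain_cons.1 h).1]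
  · rw [annihilation_cons_of_ne hj, map_zero]

lemma annihilation_creation (i : ℕ+) (γ : Word) [Decidable (∀ j ∈ γ.1.head?, i ≥ j)] :
    annihilation i (creation i (basisVec γ)) =
      if ∀ j ∈ γ.1.head?, i ≥ j then basisVec γ else 0 := by
  rw [creation_basisVec]
  split_ifs with h
  · rw [annihilation_cons_self]
  · exact map_zero _

lemma creation_mul_annihilation_mul_creation (i : ℕ+) :
    creation i * annihilation i * creation i = creation i := by
  classical
  refine ext_basisVec fun γ => ?_
  rw [mul_apply_eq_comp, mul_apply_eq_comp, annihilation_creation]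
  split_ifs with h
  · rfl
  · rw [map_zero, creation_basisVec, dif_neg h]

lemma vacProj_mul_creation (i : ℕ+) : vacProj * creation i = 0 := by
  refine ext_basisVec fun γ => ?_
  rw [mul_apply_eq_comp, creation_basisVec]
  split_ifs with h
  · exact vacProj_cons _ _ _
  · exact map_zero _

lemma annihilation_mul_creation_of_ne {i j : ℕ+} (hij : i ≠ j) :
    annihilation i * creation j = 0 := by
  refine ext_basisVec fun γ => ?_
  rw [mul_apply_eq_comp, creation_basisVec]
  split_ifs with h
  · exact annihilation_cons_of_ne hij.symm _ _
  · exact map_zero _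

lemma annihilation_mul_creation_eq_sum (i : ℕ) :
    annihilation i.succPNat * creation i.succPNat =
      (∑ k ∈ Finset.range (i + 1), creation k.succPNat * annihilation k.succPNat) + vacProj := by
  classical
  refine ext_basisVec fun γ => ?_
  rw [mul_apply_eq_comp, annihilation_creation, add_apply, sum_apply]
  simp only [mul_apply_eq_comp]
  obtain ⟨_ | ⟨j, l⟩, hl⟩ := γ
  · have hannihilation : ∀ k, annihilation k (basisVec ⟨[], hl⟩) = 0 := annihilation_vac
    have hvac : vacProj (basisVec ⟨[], hl⟩) = basisVec ⟨[], hl⟩ := vacProj_vac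
    simp [hannihilation, hvac]
  · have hj : ∀ k : ℕ, j = k.succPNat ↔ j.natPred = k := fun k =>
      ⟨fun h => by rw [h, Nat.natPred_succPNat], fun h => by rw [← h, PNat.succPNat_natPred]⟩
    have hle : i.succPNat ≥ j ↔ j.natPred ∈ Finset.range (i + 1) := by
      rw [Finset.mem_range, Nat.lt_succ_iff, ge_iff_le, ← PNat.natPred_le_natPred,
        Nat.natPred_succPNat]
    simp only [creation_annihilation_cons, vacProj_cons, add_zero, List.head?_cons,
      Option.mem_def, Option.some.injEq, forall_eq', hj, Finset.sum_ite_eq, hle]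

theorem fockGen_rel : VacuumRel fockGen where
  partialIsometry
    | 0 => by
      rw [fockGen, isStarProjection_vacProj.isSelfAdjoint.star_eq,
        isStarProjection_vacProj.isIdempotentElem.eq,
        isStarProjection_vacProj.isIdempotentElem.eq]
    | i + 1 => creation_mul_annihilation_mul_creation i.succPNat
  orthogonal
    | 0, 0, hij => absurd rfl hij
    | 0, j + 1, _ => by
      rw [fockGen, fockGen, isStarProjection_vacProj.isSelfAdjoint.star_eq, vacProj_mul_creation]
    | i + 1, 0, _ => by
      rw [fockGen, fockGen, ← isStarProjection_vacProj.isSelfAdjoint.star_eq, ← star_mul,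
        vacProj_mul_creation, star_zero]
    | i + 1, j + 1, hij => annihilation_mul_creation_of_ne fun h =>
      hij (congrArg (· + 1) (Nat.succPNat_injective h))
  sum_range
    | 0 => by
      rw [Finset.sum_range_one, fockGen, isStarProjection_vacProj.isSelfAdjoint.star_eq]
    | i + 1 => by
      rw [Finset.sum_range_succ', fockGen, isStarProjection_vacProj.isSelfAdjoint.star_eq,
        isStarProjection_vacProj.isIdempotentElem.eq]
      exact annihilation_mul_creation_eq_sum i
  vacuum := by
    rw [fockGen, isStarProjection_vacProj.isSelfAdjoint.star_eq,
      isStarProjection_vacProj.isIdempotentElem.eq]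

lemma creation_mem_weaklyMonotoneAlg (i : ℕ+) : creation i ∈ weaklyMonotoneAlg :=
  NonUnitalStarSubalgebra.le_topologicalClosure _
    (NonUnitalStarAlgebra.subset_adjoin ℂ _ (Or.inr ⟨i, rfl⟩))

lemma vacProj_mem_weaklyMonotoneAlg : vacProj ∈ weaklyMonotoneAlg := by
  have hmem := creation_mem_weaklyMonotoneAlg (Nat.succPNat 0)
  have hvac : annihilation (Nat.succPNat 0) * creation (Nat.succPNat 0) -
      creation (Nat.succPNat 0) * annihilation (Nat.succPNat 0) = vacProj := by
    rw [annihilation_mul_creation_eq_sum, Finset.sum_range_one, add_sub_cancel_left]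
  rw [← hvac, ← star_creation]
  exact sub_mem (mul_mem (star_mem hmem) hmem) (mul_mem hmem (star_mem hmem))

lemma fockGen_mem_weaklyMonotoneAlg : ∀ i, fockGen i ∈ weaklyMonotoneAlg
  | 0 => vacProj_mem_weaklyMonotoneAlg
  | n + 1 => creation_mem_weaklyMonotoneAlg n.succPNat

lemma fockGen_natPred_succ (i : ℕ+) : fockGen (i.natPred + 1) = creation i := by
  rw [fockGen, PNat.succPNat_natPred]

end Fock

/-! ### The isomorphisms -/

section Isomorphism

variable {A : Type u} {B : Type v} [NonUnitalCStarAlgebra A] [NonUnitalCStarAlgebra B]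

lemma MonotoneRel.map {t : ℕ → A} (ht : MonotoneRel t) (φ : A →⋆ₙₐ[ℂ] B) :
    MonotoneRel fun i => φ (t i) where
  partialIsometry i := by rw [← map_star, ← map_mul, ← map_mul, ht.partialIsometry]
  orthogonal i j hij := by rw [← map_star, ← map_mul, ht.orthogonal i j hij, map_zero]
  sum_range i := by
    simp only [← map_star, ← map_mul, ← map_sum]
    rw [ht.sum_range]

lemma VacuumRel.map {t : ℕ → A} (ht : VacuumRel t) (φ : A →⋆ₙₐ[ℂ] B) :
    VacuumRel fun i => φ (t i) where
  toMonotoneRel := ht.toMonotoneRel.map φ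
  vacuum := by rw [← map_star, ← map_mul, ← ht.vacuum]

lemma VacuumRel.pi {ι : Type u} [Fintype ι] {t : ι → ℕ → B} (ht : ∀ k, VacuumRel (t k)) :
    VacuumRel (B := ι → B) fun i k => t k i where
  partialIsometry i := funext fun k => (ht k).partialIsometry i
  orthogonal i j hij := funext fun k => (ht k).orthogonal i j hij
  sum_range i := funext fun k => by
    rw [Finset.sum_apply]
    exact (ht k).sum_range i
  vacuum := funext fun k => (ht k).vacuum

lemma exists_fockRep (P : ∀ (B : Type u) [NonUnitalCStarAlgebra B], (ℕ → B) → Prop)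
    (hP : ∀ (B : Type u) [NonUnitalCStarAlgebra B] (t : ℕ → B), VacuumRel t → P B t) :
    ∃ π : UniversalCStar P →⋆ₙₐ[ℂ] (Fock →L[ℂ] Fock), ∀ i, π (universalGen P i) = fockGen i := by
  -- Operators on `Fock` live in `Type`; functions on `PUnit` lift them to the universe of models.
  have hrel := VacuumRel.pi fun _ : PUnit.{u + 1} => fockGen_rel
  let model : Model P := ⟨PUnit.{u + 1} → (Fock →L[ℂ] Fock), fun i _ => fockGen i,
    hrel.partialIsometry, hP _ _ hrel⟩
  exact ⟨(Pi.evalNonUnitalStarAlgHom ℂ (fun _ : PUnit.{u + 1} => Fock →L[ℂ] Fock)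
    PUnit.unit).comp (evalModel P model), fun _ => rfl⟩

lemma range_eq_topologicalClosure_adjoin {π : A →⋆ₙₐ[ℂ] B} (hπ : Isometry π) {X : Set A}
    (hX : Dense (NonUnitalStarAlgebra.adjoin ℂ X : Set A)) :
    NonUnitalStarAlgHom.range π = (NonUnitalStarAlgebra.adjoin ℂ (π '' X)).topologicalClosure := by
  refine SetLike.coe_injective ?_
  change _ = closure (NonUnitalStarAlgebra.adjoin ℂ (π '' X) : Set B)
  rw [← NonUnitalStarAlgHom.map_adjoin, NonUnitalStarSubalgebra.coe_map,
    hπ.isClosedEmbedding.closure_image_eq, hX.closure_eq, Set.image_univ,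
    NonUnitalStarAlgHom.coe_range]

lemma exists_starAlgEquiv_of_range_eq {π : A →⋆ₙₐ[ℂ] B} (hπ : Isometry π)
    {S : NonUnitalStarSubalgebra ℂ B} (hS : NonUnitalStarAlgHom.range π = S) :
    ∃ Φ : A ≃⋆ₐ[ℂ] S, Isometry Φ ∧ ∀ x, (Φ x : B) = π x := by
  subst hS
  exact ⟨StarAlgEquiv.ofInjective' π hπ.injective, hπ, fun _ => rfl⟩

lemma topologicalClosure_adjoin_range_fockGen :
    (NonUnitalStarAlgebra.adjoin ℂ (Set.range fockGen)).topologicalClosure =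
      weaklyMonotoneAlg := by
  refine le_antisymm (NonUnitalStarSubalgebra.topologicalClosure_minimal _
    (NonUnitalStarAlgebra.adjoin_le ?_) (NonUnitalStarSubalgebra.isClosed_topologicalClosure _))
    (NonUnitalStarSubalgebra.topologicalClosure_mono (NonUnitalStarAlgebra.adjoin_le ?_))
  · rintro _ ⟨i, rfl⟩
    exact fockGen_mem_weaklyMonotoneAlg i
  · have hcreation : ∀ i,
        creation i ∈ NonUnitalStarAlgebra.adjoin ℂ (Set.range fockGen) := fun i =>
      NonUnitalStarAlgebra.subset_adjoin ℂ _ ⟨_, fockGen_natPred_succ i⟩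
    rintro _ (⟨i, rfl⟩ | ⟨i, rfl⟩)
    · exact star_mem (hcreation i)
    · exact hcreation i

theorem VacuumRel.exists_starAlgEquiv {t : ℕ → A} (ht : VacuumRel t)
    {π : A →⋆ₙₐ[ℂ] (Fock →L[ℂ] Fock)} (hπ : ∀ i, π (t i) = fockGen i)
    (hdense : Dense (NonUnitalStarAlgebra.adjoin ℂ (Set.range t) : Set A)) :
    ∃ Φ : A ≃⋆ₐ[ℂ] weaklyMonotoneAlg, Isometry Φ ∧ ∀ x, (Φ x : Fock →L[ℂ] Fock) = π x := by
  have hvacuum : π (t 0) ≠ 0 := (hπ 0).trans_ne vacProj_ne_zero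
  have hiso : Isometry π := AddMonoidHomClass.isometry_of_norm π (ht.norm_map_eq π hvacuum hdense)
  refine exists_starAlgEquiv_of_range_eq hiso ?_
  rw [range_eq_topologicalClosure_adjoin hiso hdense, ← Set.range_comp,
    show π ∘ t = fockGen from funext hπ, topologicalClosure_adjoin_range_fockGen]

lemma dense_adjoin_universalGen
    (P : ∀ (B : Type u) [NonUnitalCStarAlgebra B], (ℕ → B) → Prop) :
    Dense (NonUnitalStarAlgebra.adjoin ℂ (Set.range (universalGen P)) :
      Set (UniversalCStar P)) := by
  let ι : UniversalCStar P →⋆ₙₐ[ℂ] ModelProduct P :=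
    NonUnitalStarSubalgebraClass.subtype (universalSubalgebra P)
  have hmap : (NonUnitalStarAlgebra.adjoin ℂ (Set.range (universalGen P))).map ι =
      NonUnitalStarAlgebra.adjoin ℂ (Set.range (productGen P)) := by
    rw [NonUnitalStarAlgHom.map_adjoin, ← Set.range_comp]
    rfl
  intro x
  refine closure_subtype.2 ?_
  have hx : x.1 ∈ closure
      (NonUnitalStarAlgebra.adjoin ℂ (Set.range (productGen P)) : Set (ModelProduct P)) := x.2
  rw [← hmap] at hx
  exact hx

lemma quot_rel : VacuumRel fun i => J.{u}.quotHom (OAN.s i) where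
  toMonotoneRel := OAN.rel.map J.{u}.quotHom
  vacuum := by
    rw [← map_star, ← map_mul]
    exact CStarIdeal.mk_eq_mk.2 (subset_closedIdealSpan _ rfl)

lemma CStarIdeal.dense_adjoin_image_quotHom (I : CStarIdeal A) {X : Set A}
    (hX : Dense (NonUnitalStarAlgebra.adjoin ℂ X : Set A)) :
    Dense (NonUnitalStarAlgebra.adjoin ℂ (I.quotHom '' X) : Set I.Quot) := by
  have hsurj : Function.Surjective I.quotHom := CStarIdeal.mk_surjective
  rw [← NonUnitalStarAlgHom.map_adjoin]
  exact hsurj.denseRange.dense_image (map_continuous I.quotHom) hX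

lemma IsClosedIdeal.ker (φ : A →⋆ₙₐ[ℂ] B) :
    IsClosedIdeal (LinearMap.ker (φ : A →ₗ[ℂ] B)) where
  closed := isClosed_singleton.preimage (map_continuous φ)
  mul_left a x (hx : φ x = 0) := (map_mul φ a x).trans (by rw [hx, mul_zero])
  mul_right a x (hx : φ x = 0) := (map_mul φ x a).trans (by rw [hx, zero_mul])

lemma map_eq_zero_of_mem_J (φ : OAN.{u} →⋆ₙₐ[ℂ] B)
    (hφ : φ (OAN.s 0) = φ (OAN.s 0) * star (φ (OAN.s 0))) :
    ∀ x ∈ J.{u}.carrier, φ x = 0 := by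
  have hgen : φ (OAN.s 0 - OAN.s 0 * star (OAN.s 0)) = 0 := by
    rw [map_sub, map_mul, map_star, ← hφ, sub_self]
  exact sInf_le (a := LinearMap.ker (φ : OAN.{u} →ₗ[ℂ] B))
    ⟨IsClosedIdeal.ker φ, Set.singleton_subset_iff.2 hgen⟩

theorem exists_starAlgEquiv_quot {π : OAN.{u} →⋆ₙₐ[ℂ] (Fock →L[ℂ] Fock)}
    (hπ : ∀ i, π (OAN.s i) = fockGen i) :
    ∃ Φ : J.{u}.Quot ≃⋆ₐ[ℂ] weaklyMonotoneAlg,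
      Isometry Φ ∧ ∀ x, (Φ (J.toQuot x) : Fock →L[ℂ] Fock) = π x := by
  have hJ : ∀ x ∈ J.{u}.carrier, π x = 0 :=
    map_eq_zero_of_mem_J π (by rw [hπ]; exact fockGen_rel.vacuum)
  have hdense := J.{u}.dense_adjoin_image_quotHom (dense_adjoin_universalGen.{u} _)
  rw [← Set.range_comp] at hdense
  obtain ⟨Φ, hΦ, hΦπ⟩ := quot_rel.{u}.exists_starAlgEquiv (π := CStarIdeal.quotLift π hJ) hπ hdense
  exact ⟨Φ, hΦ, fun x => hΦπ (J.toQuot x)⟩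

lemma existsUnique_hom_of_starAlgEquiv
    {P : ∀ (B : Type u) [NonUnitalCStarAlgebra B], (ℕ → B) → Prop}
    {C : Type v} [NonUnitalCStarAlgebra C] (Ψ : UniversalCStar P ≃⋆ₐ[ℂ] C) {B : Type u}
    [NonUnitalCStarAlgebra B] {t : ℕ → B}
    (hpi : ∀ i, t i * star (t i) * t i = t i) (ht : P B t) :
    ∃! φ : C →⋆ₙₐ[ℂ] B, ∀ i, φ (Ψ (universalGen P i)) = t i := by
  obtain ⟨φ, hφ, hunique⟩ := existsUnique_lift P t hpi ht
  refine ⟨φ.comp (Ψ.symm : C →⋆ₙₐ[ℂ] UniversalCStar P), fun i => ?_, fun χ hχ => ?_⟩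
  · exact (congrArg φ (Ψ.symm_apply_apply _)).trans (hφ i)
  · ext y
    rw [← hunique (χ.comp (Ψ : UniversalCStar P →⋆ₙₐ[ℂ] C)) hχ]
    exact congrArg χ (Ψ.apply_symm_apply y).symm

end Isomorphism

end WeaklyMonotone

end

theorem mainTheorem8 :
    -- the Fock representation induces an isometric isomorphism of `O_{A_ℕ} / J` onto `𝒲_ℕ`
    (∃ πF : WeaklyMonotone.OAN.{u} →⋆ₙₐ[ℂ] (WeaklyMonotone.Fock →L[ℂ] WeaklyMonotone.Fock),
      (∀ i, πF (WeaklyMonotone.OAN.s i) = WeaklyMonotone.fockGen i) ∧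
      ∃ Φ : WeaklyMonotone.J.{u}.Quot ≃⋆ₐ[ℂ] WeaklyMonotone.weaklyMonotoneAlg,
        Isometry Φ ∧ ∀ x, (Φ (WeaklyMonotone.J.toQuot x) :
          WeaklyMonotone.Fock →L[ℂ] WeaklyMonotone.Fock) = πF x) ∧
    -- `𝒲_ℕ` is isomorphic to the universal C⋆-algebra of the relations with `s₀ = s₀ s₀*`
    (∃ Ψ : WeaklyMonotone.VacuumOAN.{u} ≃⋆ₐ[ℂ] WeaklyMonotone.weaklyMonotoneAlg,
      Isometry Ψ ∧ ∀ i, (Ψ (WeaklyMonotone.VacuumOAN.s i) :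
        WeaklyMonotone.Fock →L[ℂ] WeaklyMonotone.Fock) = WeaklyMonotone.fockGen i) ∧
    -- that is, it has the universal property
    (∃ g : ℕ → WeaklyMonotone.weaklyMonotoneAlg,
      (∀ i, (g i : WeaklyMonotone.Fock →L[ℂ] WeaklyMonotone.Fock) = WeaklyMonotone.fockGen i) ∧
      WeaklyMonotone.VacuumRel g ∧
      ∀ (B : Type u) [NonUnitalCStarAlgebra B] (t : ℕ → B), WeaklyMonotone.VacuumRel t →
        ∃! φ : WeaklyMonotone.weaklyMonotoneAlg →⋆ₙₐ[ℂ] B, ∀ i, φ (g i) = t i) := by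
  obtain ⟨πF, hπF⟩ := WeaklyMonotone.exists_fockRep.{u}
    (fun _ _ t => WeaklyMonotone.MonotoneRel t) fun _ _ _ h => h.toMonotoneRel
  obtain ⟨πV, hπV⟩ := WeaklyMonotone.exists_fockRep.{u}
    (fun _ _ t => WeaklyMonotone.VacuumRel t) fun _ _ _ h => h
  obtain ⟨Ψ, hΨ, hΨπ⟩ := WeaklyMonotone.VacuumOAN.rel.{u}.exists_starAlgEquiv hπV
    (WeaklyMonotone.dense_adjoin_universalGen _)
  have hΨgen (i : ℕ) : (Ψ (WeaklyMonotone.VacuumOAN.s i) :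
      WeaklyMonotone.Fock →L[ℂ] WeaklyMonotone.Fock) = WeaklyMonotone.fockGen i :=
    (hΨπ _).trans (hπV i)
  exact ⟨⟨πF, hπF, WeaklyMonotone.exists_starAlgEquiv_quot hπF⟩, ⟨Ψ, hΨ, hΨgen⟩,
    fun i => Ψ (WeaklyMonotone.VacuumOAN.s i), hΨgen,
    WeaklyMonotone.VacuumOAN.rel.map
      (Ψ : WeaklyMonotone.VacuumOAN.{u} →⋆ₙₐ[ℂ] WeaklyMonotone.weaklyMonotoneAlg),
    fun _ _ _ ht => WeaklyMonotone.existsUnique_hom_of_starAlgEquiv Ψ ht.partialIsometry ht⟩
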